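/- Let $V$ be a finite-dimensional real vector space, $\mathcal Q=S^2V^*$ the space of symmetric bilinear forms on $V$, and $\mathrm{Gr}_d(\mathcal Q)$ the Grassmannian of $d$-dimensional linear subspaces of $\mathcal Q$, so that $T_P\mathrm{Gr}_d(\mathcal Q)=\mathrm{Hom}(P,\mathcal Q/P)$. A form in $\mathcal Q$ is called positive if it is positive definite. Let $M$ be a smooth manifold of dimension $d$ (Hausdorff, second countable, without boundary). A smooth immersion $u:M\to \mathrm{Gr}_d(\mathcal Q)$ is called a fitting immersion if for all $x\in M$ and all nonzero $v\in T_xM$ the image of $du_x(v)\in\mathrm{Hom}(u(x),\mathcal Q/u(x))$ contains the class of a positive form. Let $u^*\mathcal E=\{(x,q)\in M\times\mathcal Q : q\in u(x)\}$ be the pullback of the tautological bundle, $\pi:u^*\mathcal E\to\mathcal Q$, $\pi(x,q)=q$, and let $\mathbb S u^*\mathcal E$ be the sphere bundle, i.e. the quotient of $u^*\mathcal E$ minus its zero section by multiplication with positive scalars. A fitting flow for $u$ is a continuous flow $(\Phi_t)_{t\in\mathbb R}$ on $\mathbb S u^*\mathcal E$ such that for all $t>0$ and every nonzero $q\in u^*\mathcal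 E$ there is a representative $q'$ of $\Phi_t([q])$ such that $\pi(q')-\pi(q)$ is positive. **Proposition 4.8.** (i) Every fitting immersion $u:M\to\mathrm{Gr}_d(\mathcal Q)$ admits a fitting flow. (ii) Let $\Gamma$ be a discrete group with a proper action on $M$ by homeomorphisms, i.e. such that for all compact $K,L\subset M$ the set $\{\gamma\in\Gamma : \gamma K\cap L\neq\emptyset\}$ is finite, let $\rho:\Gamma\to\mathrm{SL}(V)$ be a homomorphism, and let $\mathrm{SL}(V)$ act on $\mathcal Q$ by $(g\cdot q)(v,w)=q(g^{-1}v,g^{-1}w)$. If $u:M\to\mathrm{Gr}_d(\mathcal Q)$ is a fitting immersion with $u(\gamma x)=\rho(\gamma)u(x)$ for all $\gamma\in\Gamma$, $x\in M$, then $u$ admits a fitting flow $\Phi$ that is $\rho$-equivariant, i.e. $\Phi_t\circ\gamma=\gamma\circ\Phi_t$ for all $t\in\mathbb R$ and $\gamma\in\Gamma$, where $\gamma\cdot(x,[q])=(\gamma x,[\rho(\gamma)\cdot q])$ on $\mathbb S u^*\mathcal E$. -/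

import Mathlib

open scoped Manifold ContDiff Topology

namespace FittingFlow

section Grassmannian

variable {E : Type*} [NormedAddCommGroup E] [NormedSpace ℝ E]

/-- The Grassmannian of `d`-dimensional linear subspaces of `E`. -/
def Gr (d : ℕ) (E : Type*) [NormedAddCommGroup E] [NormedSpace ℝ E] : Type _ :=
  {P : Submodule ℝ E // Module.finrank ℝ P = d}

open Classical in
/-- The affine chart of the Grassmannian around `P` attached to a complement `H` of `P`. It is
defined on the set of all `P'` transverse to `H`, and sends `P'` to the unique linear map
`A : P → H` whose graph `{p + A p | p ∈ P}` is `P'` (see `graph_graphCoord`). Explicitly, since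
`p = (p + A p) - A p`, the vector `- A p` is the projection of `p` to `H` along `P'`.
The value is `0` outside the domain of the chart. -/
noncomputable def graphCoord [FiniteDimensional ℝ E] (P H P' : Submodule ℝ E) : P →L[ℝ] H :=
  if h : IsCompl P' H then
    -(LinearMap.toContinuousLinearMap ((H.projectionOnto P' h.symm).comp P.subtype))
  else 0

theorem graph_graphCoord [FiniteDimensional ℝ E] {P H P' : Submodule ℝ E} (hP : IsCompl P H)
    (hP' : IsCompl P' H) (e : E) :
    e ∈ P' ↔ ∃ p : P, e = (p : E) + (graphCoord P H P' p : E) := by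
  have hcoord : ∀ p : P, ((graphCoord P H P' p : H) : E)
      = -((H.projectionOnto P' hP'.symm (p : E) : H) : E) := by
    intro p; simp [graphCoord, hP']
  have hmem : ∀ p : P, (p : E) + (graphCoord P H P' p : E) ∈ P' := by
    intro p
    rw [hcoord, ← sub_eq_add_neg, ← Submodule.projectionOnto_apply_eq_zero_iff hP'.symm,
      map_sub, Submodule.projectionOnto_apply_left, sub_self]
  constructor
  · intro he
    refine ⟨P.projectionOnto H hP e, ?_⟩
    set p := P.projectionOnto H hP e
    have h1 : e - ((p : E) + (graphCoord P H P' p : E)) ∈ P' := P'.sub_mem he (hmem p)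
    have h2 : e - ((p : E) + (graphCoord P H P' p : E)) ∈ H := by
      rw [← sub_sub]
      refine H.sub_mem ?_ (graphCoord P H P' p).2
      rw [← Submodule.projectionOnto_apply_eq_zero_iff hP, map_sub,
        Submodule.projectionOnto_apply_left, sub_self]
    have := Submodule.disjoint_def.1 hP'.disjoint _ h1 h2
    exact sub_eq_zero.1 this
  · rintro ⟨p, rfl⟩
    exact hmem p

variable {d k : ℕ} {M : Type*} [TopologicalSpace M] [ChartedSpace (EuclideanSpace ℝ (Fin d)) M]

/-- A map to the Grassmannian is smooth if it is so in the affine charts: for every `x` and every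
complement `H` of `u x`, all `u y` with `y` near `x` are in the domain of the chart around `u x`
attached to `H`, and `u` read in this chart is smooth at `x`. -/
def IsSmooth [FiniteDimensional ℝ E] (u : M → Gr k E) : Prop :=
  ∀ (x : M) (H : Submodule ℝ E), IsCompl (u x).1 H →
    (∀ᶠ y in 𝓝 x, IsCompl (u y).1 H) ∧
    ContMDiffAt (𝓡 d) 𝓘(ℝ, (u x).1 →L[ℝ] H) ∞ (fun y => graphCoord (u x).1 H (u y).1) x

/-- The differential of `u` at `x`, as a map from `T_x M` to `Hom(P, E/P) = T_P Gr`, `P = u x`.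
It is computed in the chart attached to a complement `H` of `P`, through the identification
`Hom(P, H) = Hom(P, E/P)` given by `H → E → E/P`; for smooth `u` it does not depend on `H`. -/
noncomputable def differential [FiniteDimensional ℝ E] (u : M → Gr k E) (x : M)
    (H : Submodule ℝ E) (v : TangentSpace (𝓡 d) x) : (u x).1 →ₗ[ℝ] E ⧸ (u x).1 :=
  let A : (u x).1 →L[ℝ] H :=
    mfderiv (𝓡 d) 𝓘(ℝ, (u x).1 →L[ℝ] H) (fun y => graphCoord (u x).1 H (u y).1) x v
  ((u x).1.mkQ.comp H.subtype).comp A.toLinearMap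

end Grassmannian

section Quadrics

variable (V : Type*) [NormedAddCommGroup V] [NormedSpace ℝ V]

/-- Linear subspaces of a normed space (an auxiliary name that guides instance search). -/
abbrev LinSubspace (E : Type*) [NormedAddCommGroup E] [NormedSpace ℝ E] : Type _ := Submodule ℝ E

/-- The space `S²V*` of symmetric bilinear forms on `V`. -/
def symmetricForms : LinSubspace (V →L[ℝ] V →L[ℝ] ℝ) where
  carrier := {q | ∀ v w, q v w = q w v}
  add_mem' := by
    intro a b ha hb v w
    simp [ha v w, hb v w]
  zero_mem' := by intro v w; simp
  smul_mem' := by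
    intro c a ha v w
    simp [ha v w]

/-- The normed space of quadrics on `V`. -/
def Quadric : Type _ := symmetricForms V

noncomputable instance : NormedAddCommGroup (Quadric V) :=
  inferInstanceAs (NormedAddCommGroup (symmetricForms V))

noncomputable instance : NormedSpace ℝ (Quadric V) :=
  inferInstanceAs (NormedSpace ℝ (symmetricForms V))

instance [FiniteDimensional ℝ V] : FiniteDimensional ℝ (Quadric V) :=
  inferInstanceAs (FiniteDimensional ℝ (symmetricForms V))

variable {V}

@[ext]
theorem Quadric.ext {q r : Quadric V} (h : ∀ v w, q.1 v w = r.1 v w) : q = r :=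
  Subtype.ext (ContinuousLinearMap.ext fun v => ContinuousLinearMap.ext fun w => h v w)

/-- Positive quadrics, that is, positive definite forms. -/
def Quadric.Pos (q : Quadric V) : Prop := ∀ v : V, v ≠ 0 → 0 < q.1 v v

/-- The action `(g • q)(v, w) = q (g⁻¹ v, g⁻¹ w)` of `SL(V)` on quadrics. -/
noncomputable def quadricAct [FiniteDimensional ℝ V] (g : SpecialLinearGroup ℝ V) :
    Quadric V →ₗ[ℝ] Quadric V where
  toFun q :=
    let h : V →L[ℝ] V := LinearMap.toContinuousLinearMap (g⁻¹.1 : V →ₗ[ℝ] V)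
    ⟨q.1.bilinearComp h h, fun v w => q.2 (h v) (h w)⟩
  map_add' _ _ := rfl
  map_smul' _ _ := rfl

theorem quadricAct_apply [FiniteDimensional ℝ V] (g : SpecialLinearGroup ℝ V) (q : Quadric V)
    (v w : V) : (quadricAct g q).1 v w = q.1 (g⁻¹.1 v) (g⁻¹.1 w) := rfl

theorem quadricAct_ne_zero [FiniteDimensional ℝ V] (g : SpecialLinearGroup ℝ V) {q : Quadric V}
    (hq : q ≠ 0) : quadricAct g q ≠ 0 := by
  intro h
  apply hq
  ext v w
  have := congrArg (fun r : Quadric V => r.1 (g.1 v) (g.1 w)) h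
  have e : ∀ z : V, (g⁻¹.1 : V ≃ₗ[ℝ] V) (g.1 z) = z := fun z => by
    change ((g⁻¹ * g).1 : V ≃ₗ[ℝ] V) z = z
    rw [inv_mul_cancel]; rfl
  simp only [quadricAct_apply, e] at this
  exact this

/-- A tangent vector `v ∈ Hom(P, 𝒬/P)` to the Grassmannian at `P` is fitting if its image contains
the class of a positive quadric. -/
def IsFittingVector (P : Submodule ℝ (Quadric V)) (v : P →ₗ[ℝ] Quadric V ⧸ P) : Prop :=
  ∃ (p : P) (q : Quadric V), q.Pos ∧ v p = P.mkQ q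

variable {d : ℕ} {M : Type*} [TopologicalSpace M] [ChartedSpace (EuclideanSpace ℝ (Fin d)) M]

/-- Fitting immersions of a `d`-dimensional manifold: smooth immersions to `Gr_d(𝒬)` all of whose
(nonzero) tangent directions are fitting. -/
structure IsFittingImmersion [FiniteDimensional ℝ V] (u : M → Gr d (Quadric V)) : Prop where
  smooth : IsSmooth (d := d) u
  immersion : ∀ (x : M) (H : Submodule ℝ (Quadric V)), IsCompl (u x).1 H →
    ∀ v : TangentSpace (𝓡 d) x, v ≠ 0 → differential u x H v ≠ 0
  fitting : ∀ (x : M) (H : Submodule ℝ (Quadric V)), IsCompl (u x).1 H →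
    ∀ v : TangentSpace (𝓡 d) x, v ≠ 0 → IsFittingVector (u x).1 (differential u x H v)

end Quadrics

section SphereBundle

variable {V : Type*} [NormedAddCommGroup V] [NormedSpace ℝ V] {d : ℕ}
  {M : Type*} [TopologicalSpace M]

/-- The pullback `u*ℰ` of the tautological bundle without its zero section, as a subspace of
`M × 𝒬`: pairs `(x, q)` with `0 ≠ q ∈ u x`. -/
abbrev PuncturedBundle (u : M → Gr d (Quadric V)) : Type _ :=
  {a : M × Quadric V // a.2 ∈ (u a.1).1 ∧ a.2 ≠ 0}

/-- Two nonzero elements of `u*ℰ` are equivalent if they lie in the same fiber and differ by a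
positive scalar. -/
def positiveScaling (u : M → Gr d (Quadric V)) : Setoid (PuncturedBundle u) where
  r a b := a.1.1 = b.1.1 ∧ ∃ c : ℝ, 0 < c ∧ b.1.2 = c • a.1.2
  iseqv := by
    refine ⟨fun a => ⟨rfl, 1, one_pos, by simp⟩, ?_, ?_⟩
    · rintro a b ⟨h, c, hc, hb⟩
      exact ⟨h.symm, c⁻¹, inv_pos.2 hc, by rw [hb, smul_smul, inv_mul_cancel₀ hc.ne', one_smul]⟩
    · rintro a b e ⟨h, c, hc, hb⟩ ⟨h', c', hc', he⟩
      exact ⟨h.trans h', c' * c, mul_pos hc' hc, by rw [he, hb, smul_smul]⟩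

/-- The sphere bundle `𝕊u*ℰ`, with the quotient topology. -/
abbrev SphereBundle (u : M → Gr d (Quadric V)) : Type _ := Quotient (positiveScaling u)

/-- The class in `𝕊u*ℰ` of a nonzero element of `u*ℰ`. -/
def SphereBundle.mk {u : M → Gr d (Quadric V)} (a : PuncturedBundle u) : SphereBundle u :=
  Quotient.mk (positiveScaling u) a

/-- A continuous flow on `𝕊u*ℰ` is fitting if for all `t > 0` and every representative `q` of an
element of `𝕊u*ℰ` there is a representative `q'` of its image under `Φ_t` such that
`π(q') - π(q)` is positive. -/
def IsFittingFlow {u : M → Gr d (Quadric V)} (Φ : Flow ℝ (SphereBundle u)) : Prop :=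
  ∀ t : ℝ, 0 < t → ∀ a : PuncturedBundle u, ∃ b : PuncturedBundle u,
    SphereBundle.mk b = Φ t (SphereBundle.mk a) ∧ (b.1.2 - a.1.2).Pos

variable [FiniteDimensional ℝ V] {Γ : Type*} [Group Γ] [MulAction Γ M]

/-- Equivariance of `u` for `ρ`: one has `u (γ x) = ρ(γ) (u x)`. -/
def IsEquivariant (ρ : Γ →* SpecialLinearGroup ℝ V) (u : M → Gr d (Quadric V)) : Prop :=
  ∀ (γ : Γ) (x : M), (u (γ • x)).1 = (u x).1.map (quadricAct (ρ γ))

/-- The action `γ (x, [q]) = (γ x, [ρ(γ) q])` of `Γ` on `𝕊u*ℰ` when `u` is equivariant. -/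
noncomputable def sphereAct {ρ : Γ →* SpecialLinearGroup ℝ V} {u : M → Gr d (Quadric V)}
    (hu : IsEquivariant ρ u) (γ : Γ) : SphereBundle u → SphereBundle u :=
  Quotient.map
    (fun a => ⟨(γ • a.1.1, quadricAct (ρ γ) a.1.2),
      by rw [hu γ a.1.1]; exact Submodule.mem_map_of_mem a.2.1,
      quadricAct_ne_zero _ a.2.2⟩)
    (by
      rintro a b ⟨h, c, hc, hb⟩
      exact ⟨congrArg (γ • ·) h, c, hc, by simp [hb]⟩)

end SphereBundle

end FittingFlow

/-! The flow comes from integrating a vector field `X` on the nonzero part of `u*ℰ` whose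
`𝒬`-component is positive definite at every point. Along an integral curve `(x_s, q_s)` each number
`q_s(v, v)` with `v ≠ 0` is then strictly increasing, so `q_t - q_0` is positive for `t > 0`
(`BundleODE.pos_sub`). If `X` is complete and invariant under `Γ` and under positive scalings,
uniqueness of integral curves makes its flow commute with these symmetries, and it descends to an
equivariant fitting flow on the sphere bundle.

Pointwise, a tangent vector with positive `𝒬`-component exists over every nonzero `q ∈ u x` because
`M` and `u x` have the same dimension. Otherwise a linear form `f` vanishing on `u x` would separate
the positive cone from the directions available at `q`; the square linear map `v ↦ f ∘ du(v)` from
`T_x M` to the dual of `u x` would miss some functional, hence have a kernel, and a kernel vector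
contradicts the fitting condition (`exists_mem_cone_of_fitting`). Tangency and positivity are convex
conditions, so local solutions are patched by a partition of unity over the unit sphere of each
fibre and extended by homogeneity. Averaging with cutoff functions that are locally finite over `ℕ ×
Γ` gives equivariance (`IsPositiveField.exists_equivariant`). The homeomorphisms in `Γ` are
automatically smooth, since `u` is an equivariant immersion.

For completeness, `X` is divided by a positive function so that an invariant `h : M → ℝ`, whose
sublevel sets are compact modulo `Γ`, changes at speed at most 1. In bounded time an integral curve
stays in a set that is compact modulo `Γ` and scaling, where local existence times are bounded below
(`hasUniformDuration_bundleODE`).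

The bundle is never given charts. Locally it is the image of the smooth map `(x, q) ↦ (x, P q)`,
with `P` the projection onto `u x` along a fixed `H`; tangency is expressed by the derivative of
`P`, and integral curves are curves in `M × 𝒬` that take values in the bundle. -/

namespace FittingFlow
open Set

/-! ### Abstract integral curves and global flows -/

section LocalODE

variable {N : Type*} [TopologicalSpace N]

/-- A local, translation invariant notion of integral curves on a topological space, with local
uniqueness and with continuous local flows. -/
structure IsLocalODE (D : (ℝ → N) → ℝ → Prop) : Prop where
  congr : ∀ {c c' : ℝ → N} {t : ℝ}, c =ᶠ[𝓝 t] c' → D c t → D c' t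
  translate : ∀ {c : ℝ → N} {s t : ℝ}, D c (s + t) → D (fun r => c (s + r)) t
  cont : ∀ {c : ℝ → N} {t : ℝ}, D c t → ContinuousAt c t
  unique : ∀ {c c' : ℝ → N} {t : ℝ}, (∀ᶠ s in 𝓝 t, D c s) → (∀ᶠ s in 𝓝 t, D c' s) →
    c t = c' t → c =ᶠ[𝓝 t] c'
  flow : ∀ p : N, ∃ U ∈ 𝓝 p, ∃ ε > 0, ∃ φ : ℝ × N → N, ContinuousOn φ (Ioo (-ε) ε ×ˢ U) ∧
    ∀ y ∈ U, φ (0, y) = y ∧ ∀ t ∈ Ioo (-ε) ε, D (fun s => φ (s, y)) t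

variable {D : (ℝ → N) → ℝ → Prop}

theorem IsLocalODE.eqOn_Ioo [T2Space N] (hD : IsLocalODE D) {c c' : ℝ → N} {a b t₀ : ℝ}
    (ht₀ : t₀ ∈ Ioo a b) (hc : ∀ t ∈ Ioo a b, D c t) (hc' : ∀ t ∈ Ioo a b, D c' t)
    (h : c t₀ = c' t₀) : EqOn c c' (Ioo a b) := by
  have hU : IsOpen {t | c =ᶠ[𝓝 t] c'} := isOpen_setOfPred_eventually_nhds
  have hV : IsOpen {t | ∀ᶠ s in 𝓝 t, c s ≠ c' s} := isOpen_setOfPred_eventually_nhds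
  have hev : ∀ {e : ℝ → N}, (∀ t ∈ Ioo a b, D e t) → ∀ t ∈ Ioo a b, ∀ᶠ s in 𝓝 t, D e s :=
    fun he t ht => Filter.mem_of_superset (isOpen_Ioo.mem_nhds ht) he
  -- Connectedness: agreement at a time spreads by local uniqueness, disagreement by continuity in a
  -- Hausdorff space.
  have key : Ioo a b ⊆ {t | c =ᶠ[𝓝 t] c'} := by
    refine isPreconnected_Ioo.subset_left_of_subset_union hU hV ?_ ?_ ?_
    · rw [Set.disjoint_left]
      intro t h1 h2
      exact h2.self_of_nhds h1.self_of_nhds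
    · intro t ht
      by_cases e : c t = c' t
      · exact Or.inl (hD.unique (hev hc t ht) (hev hc' t ht) e)
      · exact Or.inr ((hD.cont (hc t ht)).ne_iff_eventually_ne (hD.cont (hc' t ht)) |>.1 e)
    · exact ⟨t₀, ht₀, hD.unique (hev hc t₀ ht₀) (hev hc' t₀ ht₀) h⟩
  exact fun t ht => (key ht).self_of_nhds

/-- Follow `c` up to `t₀` and `c'` afterwards. Local uniqueness makes the germs at `t₀` equal, so
the junction is again a solution. -/
theorem IsLocalODE.glue [T2Space N] (hD : IsLocalODE D) {c c' : ℝ → N} {a b a' b' t₀ : ℝ}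
    (ht₀ : t₀ ∈ Ioo a b) (ht₀' : t₀ ∈ Ioo a' b') (hc : ∀ t ∈ Ioo a b, D c t)
    (hc' : ∀ t ∈ Ioo a' b', D c' t) (h : c t₀ = c' t₀) :
    ∃ e : ℝ → N, (∀ t ∈ Ioo a b', D e t) ∧ e t₀ = c t₀ ∧ ∀ t ≤ t₀, e t = c t := by
  have hev : c =ᶠ[𝓝 t₀] c' :=
    hD.unique (Filter.mem_of_superset (isOpen_Ioo.mem_nhds ht₀) hc)
      (Filter.mem_of_superset (isOpen_Ioo.mem_nhds ht₀') hc') h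
  refine ⟨fun t => if t ≤ t₀ then c t else c' t, ?_, by simp, fun t ht => by simp [ht]⟩
  intro t ht
  rcases lt_trichotomy t t₀ with h1 | h1 | h1
  · refine hD.congr ?_ (hc t ⟨ht.1, h1.trans ht₀.2⟩)
    filter_upwards [Iio_mem_nhds h1] with s hs
    simp [(mem_Iio.1 hs).le]
  · subst h1
    refine hD.congr ?_ (hc t ht₀)
    filter_upwards [hev] with s hs
    split_ifs
    · rfl
    · exact hs
  · refine hD.congr ?_ (hc' t ⟨ht₀'.1.trans h1, ht.2⟩)
    filter_upwards [Ioi_mem_nhds h1] with s hs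
    simp [not_le.2 (mem_Ioi.1 hs)]

/-- Short-time solutions exist for a duration that is bounded below along every solution of
bounded length. -/
def HasUniformDuration (D : (ℝ → N) → ℝ → Prop) : Prop :=
  ∀ (y : N) (T : ℝ), ∃ ε > 0, ∀ (c : ℝ → N) (a : ℝ), 0 < a → a ≤ T → c 0 = y →
    (∀ t ∈ Ioo (-a) a, D c t) → ∀ t ∈ Ioo (-a) a,
      ∃ c' : ℝ → N, c' 0 = c t ∧ ∀ s ∈ Ioo (-ε) ε, D c' s

/-- A solution on `(-a, a)` with `a ≤ T` is prolonged at both ends by restarting it near `±a`. The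
gain `ε / 2` does not depend on `a`, so finitely many steps reach `T`. -/
theorem IsLocalODE.exists_solution [T2Space N] (hD : IsLocalODE D) (hU : HasUniformDuration D)
    (y : N) (T : ℝ) : ∃ c : ℝ → N, c 0 = y ∧ ∀ t ∈ Ioo (-T) T, D c t := by
  obtain ⟨ε, hε, H⟩ := hU y T
  let P : ℝ → Prop := fun a => ∃ c : ℝ → N, c 0 = y ∧ ∀ t ∈ Ioo (-a) a, D c t
  have mono : ∀ a b, a ≤ b → P b → P a := by
    rintro a b hab ⟨c, h0, hc⟩
    exact ⟨c, h0, fun t ht => hc t ⟨by linarith [ht.1], by linarith [ht.2]⟩⟩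
  have step : ∀ a, 0 < a → a ≤ T → P a → P (a + ε / 2) := by
    rintro a ha haT ⟨c, h0, hc⟩
    -- The restart points `±(a - δ)` lie inside the interval as `δ < a`; as `δ ≤ ε / 2`, a restart
    -- lasting `ε` passes `±(a + ε / 2)`.
    let δ := min a ε / 2
    have hδ : 0 < δ := by positivity
    have hδa : δ < a := by
      have := min_le_left a ε
      simp only [δ]; linarith
    have hδε : δ ≤ ε / 2 := by
      have := min_le_right a ε
      simp only [δ]; linarith
    have shift : ∀ r ∈ Ioo (-a) a, ∃ c' : ℝ → N, c' r = c r ∧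
        ∀ s ∈ Ioo (r - ε) (r + ε), D c' s := by
      intro r hr
      obtain ⟨c', h', hc'⟩ := H c a ha haT h0 hc r hr
      refine ⟨fun s => c' (-r + s), by simpa using h', fun s hs => hD.translate ?_⟩
      exact hc' _ ⟨by linarith [hs.1], by linarith [hs.2]⟩
    obtain ⟨c₁, h₁, hc₁⟩ := shift (a - δ) ⟨by linarith, by linarith⟩
    obtain ⟨c₂, h₂, hc₂⟩ := shift (-(a - δ)) ⟨by linarith, by linarith⟩
    obtain ⟨e₁, he₁, -, he₁'⟩ := hD.glue (t₀ := a - δ) ⟨by linarith, by linarith⟩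
      ⟨by linarith, by linarith⟩ hc hc₁ h₁.symm
    obtain ⟨e₂, he₂, -, he₂'⟩ := hD.glue (t₀ := -(a - δ)) (b' := a - δ + ε)
      ⟨by linarith, by linarith⟩ ⟨by linarith, by linarith⟩ hc₂ he₁
      (h₂.trans (he₁' _ (by linarith)).symm)
    have hmem : ∀ t ∈ Ioo (-(a + ε / 2)) (a + ε / 2), t ∈ Ioo (-(a - δ) - ε) (a - δ + ε) :=
      fun t ht => ⟨by linarith [ht.1], by linarith [ht.2]⟩
    -- Gluing controls `e₂` only to the left of the junction, so its value at `0` is recovered by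
    -- uniqueness.
    have h20 : e₂ 0 = e₁ 0 := by
      refine hD.eqOn_Ioo (a := -a) (b := a) (t₀ := -(a - δ)) ⟨by linarith, by linarith⟩
        (fun t ht => he₂ t (hmem t ⟨by linarith [ht.1], by linarith [ht.2]⟩))
        (fun t ht => he₁ t ⟨ht.1, by linarith [ht.2]⟩) ?_ ⟨by linarith, by linarith⟩
      rw [he₂' _ le_rfl, h₂, he₁' _ (by linarith)]
    exact ⟨e₂, by rw [h20, he₁' 0 (by linarith), h0], fun t ht => he₂ t (hmem t ht)⟩
  rcases le_or_gt T 0 with hT | hT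
  · exact ⟨fun _ => y, rfl, fun t ht => absurd (ht.1.trans ht.2) (by linarith)⟩
  obtain ⟨U, hU, a₀, ha₀, φ, -, hφ⟩ := hD.flow y
  have base : P a₀ := ⟨fun s => φ (s, y), (hφ y (mem_of_mem_nhds hU)).1,
    (hφ y (mem_of_mem_nhds hU)).2⟩
  have all : ∀ k : ℕ, P (min (a₀ + k * (ε / 2)) T) := by
    intro k
    induction k with
    | zero => exact mono _ _ (by simp) base
    | succ k ih =>
      refine mono _ _ ?_ (step _ (by positivity) (min_le_right _ _) ih)
      push_cast
      rw [← min_add_add_right]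
      exact min_le_min (by linarith) (by linarith)
  obtain ⟨k, hk⟩ := exists_nat_gt (T / (ε / 2))
  rw [div_lt_iff₀ (by positivity)] at hk
  exact mono _ _ (le_min (by linarith) le_rfl) (all k)

theorem IsLocalODE.eq_of_global [T2Space N] (hD : IsLocalODE D) {c c' : ℝ → N} (hc : ∀ t, D c t)
    (hc' : ∀ t, D c' t) (h : c 0 = c' 0) : c = c' := by
  funext t
  exact hD.eqOn_Ioo (a := -(|t| + 1)) (b := |t| + 1) (t₀ := 0)
    ⟨by linarith [abs_nonneg t], by linarith [abs_nonneg t]⟩ (fun t _ => hc t) (fun t _ => hc' t) h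
    ⟨by linarith [neg_abs_le t], by linarith [le_abs_self t]⟩

/-- A local ODE whose solutions do not escape in finite time integrates to a continuous flow. -/
theorem IsLocalODE.exists_flow [T2Space N] (hD : IsLocalODE D) (hU : HasUniformDuration D) :
    ∃ Φ : Flow ℝ N, ∀ y t, D (fun s => Φ s y) t := by
  choose C hC0 hC using hD.exists_solution hU
  -- Any solution living past time `|t|` gives the same value; `|t| + 1` is one choice of length.
  let F : ℝ → N → N := fun t y => C y (|t| + 1) t
  have hF0 : ∀ y, F 0 y = y := fun y => hC0 _ _
  have hFC : ∀ y T t, |t| < T → F t y = C y T t := by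
    intro y T t ht
    have h1 : |t| < min (|t| + 1) T := lt_min (by linarith) ht
    have h0 := abs_nonneg t
    refine hD.eqOn_Ioo (a := -min (|t| + 1) T) (b := min (|t| + 1) T) (t₀ := 0)
      ⟨by linarith, by linarith⟩ (fun s hs => hC _ _ s ?_) (fun s hs => hC _ _ s ?_)
      ((hC0 _ _).trans (hC0 _ _).symm) (abs_lt.1 h1)
    · rw [mem_Ioo, ← abs_lt] at hs ⊢; exact hs.trans_le (min_le_left _ _)
    · rw [mem_Ioo, ← abs_lt] at hs ⊢; exact hs.trans_le (min_le_right _ _)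
  have hFD : ∀ y t, D (fun s => F s y) t := by
    intro y t
    refine hD.congr ?_ (hC y (|t| + 1) t (abs_lt.1 (by linarith)))
    filter_upwards [continuous_abs.continuousAt.eventually_lt_const (lt_add_one |t|)] with s hs
    exact (hFC _ _ _ hs).symm
  have hFadd : ∀ s t y, F (s + t) y = F s (F t y) := by
    intro s t y
    have := hD.eq_of_global (c := fun r => F (t + r) y) (c' := fun r => F r (F t y))
      (fun r => hD.translate (hFD y _)) (fun r => hFD _ r) (by simp [hF0])
    simpa [add_comm] using congrFun this s
  have hFφ : ∀ (p : N), ∃ U ∈ 𝓝 p, ∃ ε > 0, ContinuousOn (Function.uncurry F)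
      (Ioo (-ε) ε ×ˢ U) := by
    intro p
    obtain ⟨U, hU, ε, hε, φ, hφc, hφ⟩ := hD.flow p
    refine ⟨U, hU, ε, hε, hφc.congr ?_⟩
    rintro ⟨t, y⟩ ⟨ht, hy⟩
    exact hD.eqOn_Ioo (t₀ := 0) ⟨by linarith, hε⟩ (fun s _ => hFD y s) (hφ y hy).2
      ((hF0 y).trans (hφ y hy).1.symm) ht
  have hFcont : Continuous (Function.uncurry F) := by
    rw [continuous_iff_continuousAt]
    rintro ⟨t₀, y₀⟩
    -- The times of joint continuity form a clopen set containing `0`: for `r` near `s`, `F s = F (s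
    -- - r) ∘ F r` transfers continuity from `r` to `s` through the local flow.
    let A : Set ℝ := {t | ContinuousAt (Function.uncurry F) (t, y₀)}
    have loc : ∀ t, ∃ V ∈ 𝓝 t, (V ∩ A).Nonempty → V ⊆ A := by
      intro t
      obtain ⟨U, hU, ε, hε, hc⟩ := hFφ (F t y₀)
      have h1 : ∀ᶠ s in 𝓝 t, F s y₀ ∈ interior U :=
        (hD.cont (hFD y₀ t)).eventually (isOpen_interior.mem_nhds (mem_interior_iff_mem_nhds.2 hU))
      refine ⟨{s | F s y₀ ∈ interior U} ∩ Ioo (t - ε / 2) (t + ε / 2),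
        Filter.inter_mem h1 (Ioo_mem_nhds (by linarith) (by linarith)), ?_⟩
      rintro ⟨r, ⟨hr, hr'⟩, hrA⟩ s ⟨-, hs'⟩
      have hin : ContinuousAt (fun z : ℝ × N => F r z.2) (s, y₀) :=
        ContinuousAt.comp (x := (s, y₀)) (f := fun z : ℝ × N => (r, z.2))
          (g := Function.uncurry F) hrA (by fun_prop)
      have hout : ContinuousAt (Function.uncurry F) (s - r, F r y₀) := by
        refine hc.continuousAt (prod_mem_nhds (Ioo_mem_nhds ?_ ?_) (mem_interior_iff_mem_nhds.1 hr))
        · linarith [hs'.1, hr'.2]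
        · linarith [hs'.2, hr'.1]
      have : ContinuousAt (fun z : ℝ × N => Function.uncurry F (z.1 - r, F r z.2)) (s, y₀) :=
        ContinuousAt.comp (x := (s, y₀)) (f := fun z : ℝ × N => (z.1 - r, F r z.2))
          (g := Function.uncurry F) hout
          ((continuousAt_fst.sub continuousAt_const).prodMk hin)
      refine this.congr (Filter.Eventually.of_forall fun z => ?_)
      simp only [Function.uncurry]
      rw [← hFadd, sub_add_cancel]
    have hA : IsClopen A := by
      constructor
      · rw [← isOpen_compl_iff, isOpen_iff_mem_nhds]
        intro t ht
        obtain ⟨V, hV, h⟩ := loc t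
        refine Filter.mem_of_superset hV fun s hs hsA => ht (h ⟨s, hs, hsA⟩ (mem_of_mem_nhds hV))
      · rw [isOpen_iff_mem_nhds]
        intro t ht
        obtain ⟨V, hV, h⟩ := loc t
        exact Filter.mem_of_superset hV (h ⟨t, mem_of_mem_nhds hV, ht⟩)
    have h0 : (0 : ℝ) ∈ A := by
      obtain ⟨U, hU, ε, hε, hc⟩ := hFφ y₀
      exact hc.continuousAt (prod_mem_nhds (Ioo_mem_nhds (by linarith) hε) hU)
    have : A = univ := hA.eq_univ ⟨0, h0⟩
    exact this.ge (mem_univ t₀)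
  exact ⟨⟨F, hFcont, hFadd, hF0⟩, hFD⟩

end LocalODE

/-! ### The cone argument, and projections along a fixed complement -/

section LinearAlgebra

variable {E : Type*} [NormedAddCommGroup E] [NormedSpace ℝ E]

/-- If every nonzero `v` in `T` is fitting for `β`, then for every nonzero `q` in `P` the
affine condition `β v q + w ∈ C` can be solved; this uses that `T` and `P` have the same
dimension. -/
theorem exists_mem_cone_of_fitting {T : Type*} [AddCommGroup T] [Module ℝ T]
    [FiniteDimensional ℝ T] {P : Submodule ℝ E} [FiniteDimensional ℝ P]
    (hdim : Module.finrank ℝ T = Module.finrank ℝ P) (β : T →ₗ[ℝ] E →ₗ[ℝ] E) {C : Set E}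
    (hCo : IsOpen C) (hCc : Convex ℝ C)
    (hfit : ∀ v, v ≠ 0 → ∃ p ∈ P, ∃ w ∈ P, β v p + w ∈ C) {q : E} (hq : q ∈ P) (hq0 : q ≠ 0) :
    ∃ v, ∃ w ∈ P, β v q + w ∈ C := by
  by_contra! hcon
  let W : Submodule ℝ E := LinearMap.range (β.flip q) ⊔ P
  have hdisj : Disjoint C (W : Set E) := by
    rw [Set.disjoint_right]
    intro e he
    obtain ⟨a, ⟨v, rfl⟩, w, hw, rfl⟩ := Submodule.mem_sup.1 he
    exact hcon v w hw
  obtain ⟨f, s, hfC, hfW⟩ := geometric_hahn_banach_open hCc hCo W.convex hdisj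
  have hs : s ≤ 0 := by simpa using hfW 0 W.zero_mem
  -- A linear form bounded below on a subspace vanishes there.
  have hf0 : ∀ e ∈ W, f e = 0 := by
    intro e he
    by_contra hne
    have h1 := hfW (((s - 1) / f e) • e) (W.smul_mem _ he)
    rw [map_smul, smul_eq_mul, div_mul_cancel₀ _ hne] at h1
    linarith
  let F : T →ₗ[ℝ] Module.Dual ℝ P :=
    { toFun := fun v => (f.toLinearMap.comp (β v)).comp P.subtype
      map_add' := fun a b => by ext; simp
      map_smul' := fun a b => by ext; simp }
  -- Every functional in the range of `F` kills `q ≠ 0`. By equality of dimensions `F` then has a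
  -- kernel vector `v`, and `f` vanishes on the point of `C` that `hfit` provides for `v`, although
  -- `f < s ≤ 0` on `C`.
  have hns : ¬ Function.Surjective F := by
    intro hsur
    have : ∀ g : Module.Dual ℝ P, g ⟨q, hq⟩ = 0 := by
      intro g
      obtain ⟨v, rfl⟩ := hsur g
      exact hf0 _ (Submodule.mem_sup_left ⟨v, rfl⟩)
    have := (Module.forall_dual_apply_eq_zero_iff ℝ (⟨q, hq⟩ : P)).1 this
    exact hq0 (congrArg Subtype.val this)
  have hni : ¬ Function.Injective F := fun h => hns <|
    (LinearMap.injective_iff_surjective_of_finrank_eq_finrank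
      (hdim.trans (Subspace.dual_finrank_eq).symm)).1 h
  rw [injective_iff_map_eq_zero] at hni
  push Not at hni
  obtain ⟨v, hFv, hv⟩ := hni
  obtain ⟨p, hp, w, hw, hC⟩ := hfit v hv
  have h1 : f (β v p) = 0 := LinearMap.congr_fun hFv ⟨p, hp⟩
  have h2 := hfC _ hC
  rw [map_add, h1, hf0 w (Submodule.mem_sup_right hw)] at h2
  linarith

open Classical in
/-- The projection onto `P` along `H`, as a continuous endomorphism (`0` if `P` and `H` are not
complementary). -/
noncomputable def projAlong [FiniteDimensional ℝ E] (H P : Submodule ℝ E) : E →L[ℝ] E :=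
  if h : IsCompl P H then LinearMap.toContinuousLinearMap (P.subtype.comp (P.projectionOnto H h))
  else 0

variable [FiniteDimensional ℝ E] {H P P' : Submodule ℝ E}

theorem projAlong_apply (h : IsCompl P H) (e : E) :
    projAlong H P e = (P.projectionOnto H h e : E) := by simp [projAlong, h]

theorem projAlong_mem (h : IsCompl P H) (e : E) : projAlong H P e ∈ P := by
  rw [projAlong_apply h]; exact Subtype.mem _

theorem projAlong_of_mem (h : IsCompl P H) {e : E} (he : e ∈ P) : projAlong H P e = e := by
  rw [projAlong_apply h]
  exact congrArg Subtype.val (Submodule.projectionOnto_apply_left h ⟨e, he⟩)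

theorem projAlong_of_mem_right (h : IsCompl P H) {e : E} (he : e ∈ H) : projAlong H P e = 0 := by
  rw [projAlong_apply h, (Submodule.projectionOnto_apply_eq_zero_iff h).2 he]; rfl

theorem projAlong_eq_self_iff (h : IsCompl P H) {e : E} : projAlong H P e = e ↔ e ∈ P :=
  ⟨fun h' => h' ▸ projAlong_mem h e, projAlong_of_mem h⟩

theorem sub_projAlong_mem (h : IsCompl P H) (e : E) : e - projAlong H P e ∈ H := by
  rw [← Submodule.projectionOnto_apply_eq_zero_iff h]
  apply Subtype.ext
  rw [← projAlong_apply h, map_sub, projAlong_of_mem h (projAlong_mem h e), sub_self]; rfl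

theorem projAlong_eq (h : IsCompl P H) {e a : E} (ha : a ∈ P) (hea : e - a ∈ H) :
    projAlong H P e = a := by
  have := projAlong_of_mem_right h hea
  rw [map_sub, projAlong_of_mem h ha] at this
  exact sub_eq_zero.1 this

theorem projAlong_comp (h : IsCompl P H) (h' : IsCompl P' H) (e : E) :
    projAlong H P' (projAlong H P e) = projAlong H P' e := by
  have := projAlong_of_mem_right h' (sub_projAlong_mem h e)
  rw [map_sub] at this
  exact (sub_eq_zero.1 this).symm

/-- The projection is an affine function of the chart coordinate of `P'`. A map to the Grassmannian
can thus be studied locally as a map to the fixed vector space of endomorphisms of `E`. -/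
theorem projAlong_eq_graphCoord (h : IsCompl P H) (h' : IsCompl P' H) :
    projAlong H P' = projAlong H P + H.subtypeL.comp ((graphCoord P H P').comp
      (LinearMap.toContinuousLinearMap (P.projectionOnto H h))) := by
  ext e
  apply projAlong_eq h'
  · rw [graph_graphCoord h h']
    refine ⟨P.projectionOnto H h e, ?_⟩
    simp [projAlong_apply h]
  · simp only [add_apply, ContinuousLinearMap.comp_apply]
    rw [← sub_sub]
    exact H.sub_mem (sub_projAlong_mem h e) (Subtype.mem _)

theorem projAlong_map (g : E ≃ₗ[ℝ] E) (h : IsCompl P H) (e : E) :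
    IsCompl (P.map (g : E →ₗ[ℝ] E)) (H.map (g : E →ₗ[ℝ] E)) ∧
    projAlong (H.map (g : E →ₗ[ℝ] E)) (P.map (g : E →ₗ[ℝ] E)) (g e) = g (projAlong H P e) := by
  have hc : IsCompl (P.map (g : E →ₗ[ℝ] E)) (H.map (g : E →ₗ[ℝ] E)) := by
    have := (Submodule.orderIsoMapComap g).isCompl_iff.1 h
    simpa using this
  refine ⟨hc, projAlong_eq hc (Submodule.mem_map_of_mem (projAlong_mem h e)) ?_⟩
  rw [← map_sub]
  exact Submodule.mem_map_of_mem (sub_projAlong_mem h e)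

variable {d k : ℕ} {M : Type*} [TopologicalSpace M] [ChartedSpace (EuclideanSpace ℝ (Fin d)) M]
  {u : M → Gr k E}

/-- The derivative of the projection onto `u y` along a fixed subspace `H`. -/
noncomputable def projDeriv (u : M → Gr k E) (H : Submodule ℝ E) (x : M) :
    TangentSpace (𝓡 d) x →L[ℝ] (E →L[ℝ] E) :=
  mfderiv (𝓡 d) 𝓘(ℝ, E →L[ℝ] E) (fun y => projAlong H (u y).1) x

/-- Near `x` the projection is a constant plus a linear image `L` of the chart coordinate.
Differentiating this and reducing modulo `u x` gives back the differential of `u`. -/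
theorem IsSmooth.contMDiffAt_projAlong_and_mkQ (hu : IsSmooth (d := d) u) {x : M}
    (h : IsCompl (u x).1 H) :
    ContMDiffAt (𝓡 d) 𝓘(ℝ, E →L[ℝ] E) ∞ (fun y => projAlong H (u y).1) x ∧
    ∀ (v : TangentSpace (𝓡 d) x) p, (u x).1.mkQ (projDeriv u H x v p) =
      differential u x H v ((u x).1.projectionOnto H h p) := by
  obtain ⟨hev, hs⟩ := hu x H h
  let L : ((u x).1 →L[ℝ] H) →L[ℝ] (E →L[ℝ] E) :=
    (ContinuousLinearMap.compL ℝ E H E H.subtypeL).comp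
      ((ContinuousLinearMap.compL ℝ E (u x).1 H).flip
        (LinearMap.toContinuousLinearMap ((u x).1.projectionOnto H h)))
  have heq : (fun y => projAlong H (u y).1) =ᶠ[𝓝 x]
      fun y => projAlong H (u x).1 + L (graphCoord (u x).1 H (u y).1) := by
    filter_upwards [hev] with y hy
    exact projAlong_eq_graphCoord h hy
  have hL : ContDiff ℝ ∞ (fun A => projAlong H (u x).1 + L A) := by fun_prop
  refine ⟨(hL.contMDiff.contMDiffAt.comp x hs).congr_of_eventuallyEq heq, fun v p => ?_⟩
  have h1 := (hs.mdifferentiableAt (by simp)).hasMFDerivAt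
  have h2 : HasMFDerivAt 𝓘(ℝ, (u x).1 →L[ℝ] H) 𝓘(ℝ, E →L[ℝ] E)
      (fun A => projAlong H (u x).1 + L A) (graphCoord (u x).1 H (u x).1) L :=
    (L.hasFDerivAt.const_add _).hasMFDerivAt
  have h3 := ((h2.comp x h1).congr_of_eventuallyEq heq).mfderiv
  rw [projDeriv, h3]
  rfl

theorem IsSmooth.contMDiffAt_projAlong (hu : IsSmooth (d := d) u) {x : M}
    (h : IsCompl (u x).1 H) :
    ContMDiffAt (𝓡 d) 𝓘(ℝ, E →L[ℝ] E) ∞ (fun y => projAlong H (u y).1) x :=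
  (hu.contMDiffAt_projAlong_and_mkQ h).1

theorem IsSmooth.mkQ_projDeriv (hu : IsSmooth (d := d) u) {x : M}
    (h : IsCompl (u x).1 H) (v : TangentSpace (𝓡 d) x) (p : (u x).1) :
    (u x).1.mkQ (projDeriv u H x v p) = differential u x H v p := by
  rw [(hu.contMDiffAt_projAlong_and_mkQ h).2, Submodule.projectionOnto_apply_left]

theorem IsSmooth.isOpen_isCompl (hu : IsSmooth (d := d) u) (H : Submodule ℝ E) :
    IsOpen {x | IsCompl (u x).1 H} :=
  isOpen_iff_mem_nhds.2 fun x hx => (hu x H hx).1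

/-- Locally the condition is the equation `P q = q`, for a projection `P` depending continuously on
the base point. -/
theorem IsSmooth.isClosed_total (hu : IsSmooth (d := d) u) :
    IsClosed {y : M × E | y.2 ∈ (u y.1).1} := by
  rw [← isOpen_compl_iff, isOpen_iff_mem_nhds]
  rintro ⟨x, q⟩ hxq
  obtain ⟨H, hH⟩ := Submodule.exists_isCompl (u x).1
  have hc : ContinuousAt (fun y : M × E => projAlong H (u y.1).1 y.2 - y.2) (x, q) := by
    have : ContinuousAt (fun y : M × E => projAlong H (u y.1).1) (x, q) :=
      ContinuousAt.comp (x := (x, q)) (f := Prod.fst) (g := fun y => projAlong H (u y).1)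
        (hu.contMDiffAt_projAlong hH).continuousAt continuousAt_fst
    exact (this.clm_apply continuousAt_snd).sub continuousAt_snd
  have h0 : projAlong H (u x).1 q - q ≠ 0 := fun h =>
    hxq ((projAlong_eq_self_iff hH).1 (sub_eq_zero.1 h))
  filter_upwards [hc.eventually_ne h0,
    continuousAt_fst.eventually (hu x H hH).1] with y hy hy' hmem
  exact hy (sub_eq_zero.2 (projAlong_of_mem hy' hmem))

end LinearAlgebra

/-! ### The open convex cone of positive forms -/

section Positive

variable {V : Type*} [NormedAddCommGroup V] [NormedSpace ℝ V]

theorem Quadric.Pos.add {q r : Quadric V} (hq : q.Pos) (hr : r.Pos) : (q + r).Pos :=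
  fun v hv => add_pos (hq v hv) (hr v hv)

theorem Quadric.Pos.smul {q : Quadric V} (hq : q.Pos) {c : ℝ} (hc : 0 < c) : (c • q).Pos :=
  fun v hv => mul_pos hc (hq v hv)

theorem convex_pos : Convex ℝ {q : Quadric V | q.Pos} := by
  rw [convex_iff_forall_pos]
  intro q hq r hr a b ha hb _
  exact (Quadric.Pos.smul hq ha).add (Quadric.Pos.smul hr hb)

/-- Evaluation of a quadric on a vector, as a continuous linear form. -/
noncomputable def evalDiag (v : V) : Quadric V →L[ℝ] ℝ :=
  (((ContinuousLinearMap.apply ℝ ℝ v).comp (ContinuousLinearMap.apply ℝ (V →L[ℝ] ℝ) v))).comp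
    (symmetricForms V).subtypeL

theorem evalDiag_apply (v : V) (q : Quadric V) : evalDiag v q = q.1 v v := rfl

/-- Positivity need only be tested on the unit sphere, which is compact. -/
theorem isOpen_pos [FiniteDimensional ℝ V] : IsOpen {q : Quadric V | q.Pos} := by
  have : FiniteDimensional ℝ V := inferInstance
  have hcont : Continuous (fun z : Quadric V × V => z.1.1 z.2 z.2) := by
    have h1 : Continuous (fun z : Quadric V × V => (z.1.1 : V →L[ℝ] V →L[ℝ] ℝ)) :=
      ((symmetricForms V).subtypeL.continuous).comp continuous_fst
    exact (h1.clm_apply continuous_snd).clm_apply continuous_snd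
  have hsph : IsCompact (Metric.sphere (0 : V) 1) := isCompact_sphere 0 1
  have heq : {q : Quadric V | q.Pos} =
      {q | ∀ v ∈ Metric.sphere (0 : V) 1, 0 < q.1 v v} := by
    ext q
    constructor
    · exact fun h v hv => h v (ne_zero_of_mem_unit_sphere ⟨v, hv⟩)
    · intro h v hv
      have hn : 0 < ‖v‖ := norm_pos_iff.2 hv
      have h1 := h (‖v‖⁻¹ • v) (by simp [norm_smul, hn.ne'])
      simp only [map_smul, smul_apply, smul_eq_mul] at h1
      have h2 : 0 < ‖v‖⁻¹ := inv_pos.2 hn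
      exact (mul_pos_iff_of_pos_left h2).1 ((mul_pos_iff_of_pos_left h2).1 h1)
  rw [heq, isOpen_iff_mem_nhds]
  intro q hq
  exact hsph.eventually_forall_of_forall_eventually fun v hv =>
    hcont.continuousAt.eventually (Ioi_mem_nhds (hq v hv))

end Positive

/-! ### Smoothness detected by an immersion -/

section Lifting

variable {d : ℕ} {M : Type*} [TopologicalSpace M] [ChartedSpace (EuclideanSpace ℝ (Fin d)) M]

/-- A continuous map is smooth as soon as its composition with an immersion is smooth. -/
theorem contMDiffAt_of_comp_immersion {F : Type*} [NormedAddCommGroup F] [NormedSpace ℝ F]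
    [FiniteDimensional ℝ F] {X : Type*} [TopologicalSpace X]
    {E' H' : Type*} [NormedAddCommGroup E'] [NormedSpace ℝ E'] [TopologicalSpace H']
    {J : ModelWithCorners ℝ E' H'} [ChartedSpace H' X] {f : M → F} {g : X → M} {x : X}
    (hg : ContinuousAt g x) (hf : ContMDiffAt (𝓡 d) 𝓘(ℝ, F) ∞ f (g x))
    (hinj : ∀ v : TangentSpace (𝓡 d) (g x), mfderiv (𝓡 d) 𝓘(ℝ, F) f (g x) v = 0 → v = 0)
    (hfg : ContMDiffAt J 𝓘(ℝ, F) ∞ (fun y => f (g y)) x) :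
    ContMDiffAt J (𝓡 d) ∞ g x := by
  let φ := extChartAt (𝓡 d) (g x)
  let z₀ := φ (g x)
  let fh : EuclideanSpace ℝ (Fin d) → F := f ∘ φ.symm
  have hfh : ContDiffAt ℝ ∞ fh z₀ := by
    have := (contMDiffAt_iff.1 hf).2
    simpa [fh, φ, z₀] using! this
  let f' : EuclideanSpace ℝ (Fin d) →L[ℝ] F := fderiv ℝ fh z₀
  have hf' : f' = mfderiv (𝓡 d) 𝓘(ℝ, F) f (g x) := by
    refine Eq.trans ?_ (hf.mdifferentiableAt (by simp)).mfderiv.symm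
    simp [f', fh, φ, z₀, writtenInExtChartAt]
    rfl
  have hker : LinearMap.ker (f' : EuclideanSpace ℝ (Fin d) →ₗ[ℝ] F) = ⊥ := by
    rw [LinearMap.ker_eq_bot']
    intro v hv
    exact hinj v (by rw [← hf']; exact hv)
  -- Composing `f`, read in a chart, with a left inverse of its derivative gives a map `k` with
  -- derivative the identity, hence a local inverse `inv`. In the chart `g` equals `inv ∘ L ∘ (f ∘
  -- g)`, which is smooth.
  obtain ⟨l, hl⟩ := LinearMap.exists_leftInverse_of_injective _ hker
  let L : F →L[ℝ] EuclideanSpace ℝ (Fin d) := LinearMap.toContinuousLinearMap l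
  let k : EuclideanSpace ℝ (Fin d) → EuclideanSpace ℝ (Fin d) := fun z => L (fh z)
  have hk : ContDiffAt ℝ ∞ k z₀ := L.contDiff.contDiffAt.comp z₀ hfh
  have hk' : HasFDerivAt k ((ContinuousLinearEquiv.refl ℝ (EuclideanSpace ℝ (Fin d)) :
      EuclideanSpace ℝ (Fin d) →L[ℝ] EuclideanSpace ℝ (Fin d))) z₀ := by
    have h1 : HasFDerivAt k (L.comp f') z₀ :=
      L.hasFDerivAt.comp z₀ (hfh.differentiableAt (by simp)).hasFDerivAt
    convert! h1 using 1
    ext1 v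
    exact (LinearMap.congr_fun hl v).symm
  let inv := hk.localInverse hk' (by simp)
  have hinv : ContDiffAt ℝ ∞ inv (k z₀) := hk.to_localInverse hk' (by simp)
  have hleft : ∀ᶠ z in 𝓝 z₀, inv (k z) = z :=
    (hk.hasStrictFDerivAt' hk' (by simp)).eventually_left_inverse
  rw [contMDiffAt_iff_target]
  refine ⟨hg, ?_⟩
  have hsmooth : ContMDiffAt J 𝓘(ℝ, EuclideanSpace ℝ (Fin d)) ∞ (fun y => inv (L (f (g y)))) x := by
    have hkz : k z₀ = L (f (g x)) := by
      simp [k, fh, z₀, φ]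
    have h1 : ContMDiffAt J 𝓘(ℝ, EuclideanSpace ℝ (Fin d)) ∞ (fun y => L (f (g y))) x :=
      L.contDiff.contMDiff.contMDiffAt.comp x hfg
    have h2 : ContMDiffAt 𝓘(ℝ, EuclideanSpace ℝ (Fin d)) 𝓘(ℝ, EuclideanSpace ℝ (Fin d)) ∞ inv
      (L (f (g x))) := by rw [← hkz]; exact hinv.contMDiffAt
    exact h2.comp x h1
  refine hsmooth.congr_of_eventuallyEq ?_
  have hφg : ContinuousAt (fun y => φ (g y)) x :=
    (continuousAt_extChartAt (g x)).comp hg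
  filter_upwards [hφg.eventually hleft,
    hg.eventually (extChartAt_source_mem_nhds (I := 𝓡 d) (g x))] with y hy hys
  change φ (g y) = _
  rw [← hy]
  simp only [k, fh, Function.comp_apply, φ]
  rw [(extChartAt (𝓡 d) (g x)).left_inv hys]

end Lifting

/-! ### The group action on forms, and its smoothness on the manifold -/

section Action

variable {V : Type*} [NormedAddCommGroup V] [NormedSpace ℝ V] [FiniteDimensional ℝ V]

theorem quadricAct_inv_apply (g : SpecialLinearGroup ℝ V) (q : Quadric V) :
    quadricAct g⁻¹ (quadricAct g q) = q := by
  ext v w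
  have e : ∀ z : V, (g⁻¹.1 : V ≃ₗ[ℝ] V) ((g⁻¹)⁻¹.1 z) = z := fun z => by
    change ((g⁻¹ * (g⁻¹)⁻¹).1 : V ≃ₗ[ℝ] V) z = z
    rw [mul_inv_cancel]; rfl
  rw [quadricAct_apply, quadricAct_apply, e, e]

theorem quadricAct_apply_inv (g : SpecialLinearGroup ℝ V) (q : Quadric V) :
    quadricAct g (quadricAct g⁻¹ q) = q := by
  simpa using quadricAct_inv_apply g⁻¹ q

theorem quadricAct_mul_apply (g h : SpecialLinearGroup ℝ V) (q : Quadric V) :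
    quadricAct (g * h) q = quadricAct g (quadricAct h q) := by
  ext v w
  rw [quadricAct_apply, quadricAct_apply, quadricAct_apply, mul_inv_rev]
  rfl

theorem quadricAct_one_apply (q : Quadric V) :
    quadricAct (1 : SpecialLinearGroup ℝ V) q = q := by
  ext v w
  rw [quadricAct_apply, inv_one]
  rfl

/-- The action of `SL(V)` on quadrics by linear automorphisms. -/
noncomputable def quadricEquiv (g : SpecialLinearGroup ℝ V) : Quadric V ≃ₗ[ℝ] Quadric V :=
  LinearEquiv.ofLinearMap (quadricAct g) (quadricAct g⁻¹)
    (LinearMap.ext fun q => quadricAct_apply_inv g q)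
    (LinearMap.ext fun q => quadricAct_inv_apply g q)

theorem Quadric.Pos.act {q : Quadric V} (hq : q.Pos) (g : SpecialLinearGroup ℝ V) :
    (quadricAct g q).Pos := by
  intro v hv
  rw [quadricAct_apply]
  exact hq _ (by simpa using hv)

theorem IsEquivariant.projAlong_smul {d : ℕ} {M : Type*} {u : M → Gr d (Quadric V)}
    {Γ : Type*} [Group Γ] [MulAction Γ M] {ρ : Γ →* SpecialLinearGroup ℝ V}
    (hρ : IsEquivariant ρ u) (γ : Γ) {x : M}
    {H : Submodule ℝ (Quadric V)} (h : IsCompl (u x).1 H) (q : Quadric V) :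
    IsCompl (u (γ • x)).1 (H.map (quadricAct (ρ γ))) ∧
    projAlong (H.map (quadricAct (ρ γ))) (u (γ • x)).1 (quadricAct (ρ γ) q) =
      quadricAct (ρ γ) (projAlong H (u x).1 q) := by
  rw [hρ γ x]
  exact projAlong_map (quadricEquiv (ρ γ)) h q

variable {d : ℕ} {M : Type*} [TopologicalSpace M] [ChartedSpace (EuclideanSpace ℝ (Fin d)) M]
  {u : M → Gr d (Quadric V)}
  {Γ : Type*} [Group Γ] [MulAction Γ M]
  {ρ : Γ →* SpecialLinearGroup ℝ V}

theorem IsFittingImmersion.projDeriv_injective (hu : IsFittingImmersion u) {x : M}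
    {H : Submodule ℝ (Quadric V)} (h : IsCompl (u x).1 H) (v : TangentSpace (𝓡 d) x)
    (hv : projDeriv u H x v = 0) : v = 0 := by
  by_contra hne
  refine hu.immersion x H h v hne ?_
  ext p
  rw [← hu.smooth.mkQ_projDeriv h, hv]
  simp

/-- The projections onto `u y` along `ρ(γ) H` have injective derivative in `y` at `γ • x`. At `γ •
y` they are the conjugates by `ρ(γ)` of the projections onto `u y` along `H`, hence smooth in `y`.
So the continuous map `γ` is smooth. -/
theorem IsFittingImmersion.contMDiff_smul [IsManifold (𝓡 d) ∞ M] [ContinuousConstSMul Γ M]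
    (hu : IsFittingImmersion u) (hρ : IsEquivariant ρ u) (γ : Γ) :
    ContMDiff (𝓡 d) (𝓡 d) ∞ (fun x : M => γ • x) := by
  intro x
  obtain ⟨H, hH⟩ := Submodule.exists_isCompl (u x).1
  have hγ := (hρ.projAlong_smul γ hH 0).1
  refine contMDiffAt_of_comp_immersion
    (f := fun y => projAlong (H.map (quadricAct (ρ γ))) (u y).1)
    (continuous_const_smul γ).continuousAt (hu.smooth.contMDiffAt_projAlong hγ)
    (hu.projDeriv_injective hγ) ?_
  let g : Quadric V →L[ℝ] Quadric V := LinearMap.toContinuousLinearMap (quadricAct (ρ γ))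
  let g' : Quadric V →L[ℝ] Quadric V := LinearMap.toContinuousLinearMap (quadricAct (ρ γ)⁻¹)
  let L : (Quadric V →L[ℝ] Quadric V) →L[ℝ] (Quadric V →L[ℝ] Quadric V) :=
    (ContinuousLinearMap.compL ℝ _ _ _ g).comp ((ContinuousLinearMap.compL ℝ _ _ _).flip g')
  have h1 : ContMDiffAt (𝓡 d) 𝓘(ℝ, Quadric V →L[ℝ] Quadric V) ∞
      (fun y => L (projAlong H (u y).1)) x :=
    L.contDiff.contMDiff.contMDiffAt.comp x (hu.smooth.contMDiffAt_projAlong hH)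
  refine h1.congr_of_eventuallyEq ?_
  filter_upwards [(hu.smooth x H hH).1] with y hy
  ext1 q
  have := (hρ.projAlong_smul γ hy (quadricAct (ρ γ)⁻¹ q)).2
  rw [quadricAct_apply_inv] at this
  exact this

end Action

/-! ### Cutoff functions for a proper action -/

section Cutoff

/-- By properness only finitely many `γ` can move a compact neighbourhood of `x` onto points of `K`,
and each of them keeps a small neighbourhood of `x` out of `K` if `x` is not in the set. -/
theorem isClosed_orbit_of_isCompact {M : Type*} [TopologicalSpace M] [T2Space M]
    [LocallyCompactSpace M] {Γ : Type*} [Group Γ] [MulAction Γ M] [ContinuousConstSMul Γ M]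
    [ProperlyDiscontinuousSMul Γ M] {K : Set M} (hK : IsCompact K) :
    IsClosed {x : M | ∃ γ : Γ, γ • x ∈ K} := by
  rw [← isOpen_compl_iff, isOpen_iff_mem_nhds]
  intro x hx
  obtain ⟨U, hU, hxU⟩ := exists_compact_mem_nhds x
  have hfin := ProperlyDiscontinuousSMul.finite_disjoint_inter_image (Γ := Γ) hU hK
  have h1 : ∀ γ ∈ {γ : Γ | ((γ • ·) '' U ∩ K).Nonempty}, ∀ᶠ y in 𝓝 x, γ • y ∉ K := by
    intro γ _
    exact (continuous_const_smul γ).continuousAt.eventually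
      (hK.isClosed.isOpen_compl.mem_nhds fun h => hx ⟨γ, h⟩)
  filter_upwards [hxU, (Filter.eventually_all_finite hfin).2 h1] with y hyU hy
  rintro ⟨γ, hγ⟩
  exact hy γ ⟨γ • y, ⟨y, hyU, rfl⟩, hγ⟩ hγ

variable {d : ℕ} {M : Type*} [TopologicalSpace M] [T2Space M] [SecondCountableTopology M]
  [ChartedSpace (EuclideanSpace ℝ (Fin d)) M] [IsManifold (𝓡 d) ∞ M]
  {Γ : Type*} [Group Γ] [MulAction Γ M] [ContinuousConstSMul Γ M] [ProperlyDiscontinuousSMul Γ M]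

variable (d M Γ) in
/-- Equivariantly locally finite cutoff functions. -/
theorem exists_cutoff : ∃ (φ : ℕ → M → ℝ) (C : ℕ → Set M),
    (∀ n, ContMDiff (𝓡 d) 𝓘(ℝ, ℝ) ∞ (φ n)) ∧ (∀ n x, 0 ≤ φ n x) ∧ (∀ n, IsCompact (C n)) ∧
    (∀ n, ∀ x ∈ C n, φ n x = 1) ∧ (∀ x, ∃ n, ∃ γ : Γ, γ • x ∈ C n) ∧
    LocallyFinite (fun i : ℕ × Γ => {x : M | φ i.1 (i.2 • x) ≠ 0}) := by
  have : LocallyCompactSpace M := ChartedSpace.locallyCompactSpace (EuclideanSpace ℝ (Fin d)) M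
  have : SigmaCompactSpace M := inferInstance
  let K : CompactExhaustion M := default
  let O : ℕ → Set M := fun n => {x | ∃ γ : Γ, γ • x ∈ interior (K n)}
  have hO : ∀ n, IsOpen (O n) := by
    intro n
    have : O n = ⋃ γ : Γ, (fun x : M => γ • x) ⁻¹' interior (K n) := by
      ext x; simp [O]
    rw [this]
    exact isOpen_iUnion fun γ => isOpen_interior.preimage (continuous_const_smul γ)
  -- the part of the exhaustion that is not yet covered, and the orbits to be avoided
  let C : ℕ → Set M := fun n => K n \ ⋃ m < n, O m
  let Z : ℕ → Set M := fun n => ⋃ m ∈ {m | m + 1 < n}, {x | ∃ γ : Γ, γ • x ∈ K m}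
  have hZ : ∀ n, IsClosed (Z n) := fun n =>
    (Set.finite_lt_nat n |>.subset fun m hm => by
      have : m + 1 < n := hm
      show m < n
      omega).isClosed_biUnion fun m _ =>
      isClosed_orbit_of_isCompact (K.isCompact m)
  have hC : ∀ n, IsCompact (C n) := fun n =>
    (K.isCompact n).diff (isOpen_iUnion fun m => isOpen_iUnion fun _ => hO m)
  -- The gap `m + 1 < n` in `Z n` leaves room for `K m ⊆ interior (K (m + 1))`, whose translates
  -- have been removed from `C n`.
  have hCZ : ∀ n, C n ⊆ (Z n)ᶜ := by
    rintro n x ⟨-, hx⟩ hxZ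
    simp only [Z, mem_iUnion] at hxZ
    obtain ⟨m, hm, γ, hγ⟩ := hxZ
    exact hx (mem_iUnion₂.2 ⟨m + 1, hm, γ, K.subset_interior_succ m hγ⟩)
  have hex : ∀ n, ∃ φ : M → ℝ, ContMDiff (𝓡 d) 𝓘(ℝ, ℝ) ∞ φ ∧ (∀ x, 0 ≤ φ x) ∧
      (∀ x ∈ C n, φ x = 1) ∧ ∃ S : Set M, IsCompact S ∧ Function.support φ ⊆ S \ Z n := by
    intro n
    obtain ⟨S, hS, hCS, -⟩ := exists_compact_between (hC n) isOpen_univ (subset_univ _)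
    obtain ⟨φ, h1, h2, h3, h4⟩ := exists_contMDiff_support_eq_eq_one_iff (𝓡 d) (n := (⊤ : ℕ∞))
      (isOpen_interior (s := S).inter (hZ n).isOpen_compl) (hC n).isClosed
      (subset_inter hCS (hCZ n))
    refine ⟨φ, h1, fun x => (h2 ⟨x, rfl⟩).1, fun x hx => (h4 x).1 hx, S, hS, ?_⟩
    rw [h3]
    exact inter_subset_inter_left _ interior_subset
  choose φ h1 h2 h3 S hS h4 using hex
  refine ⟨φ, C, h1, h2, hC, h3, ?_, ?_⟩
  · intro x
    classical
    -- For the least such `n`, the translate of `x` lying in `K n` was not removed by an earlier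
    -- stage, so it is in `C n`.
    have hx : ∃ n, x ∈ O n := by
      obtain ⟨n, hn⟩ := mem_iUnion.1 (K.iUnion_eq.ge (mem_univ x))
      exact ⟨n + 1, 1, by simpa using K.subset_interior_succ n hn⟩
    obtain ⟨γ, hγ⟩ := Nat.find_spec hx
    refine ⟨Nat.find hx, γ, interior_subset hγ, ?_⟩
    simp only [mem_iUnion, not_exists]
    rintro m hm ⟨δ, hδ⟩
    exact Nat.find_min hx hm ⟨δ * γ, by rwa [mul_smul]⟩
  · intro x
    obtain ⟨m, hm⟩ := mem_iUnion.1 (K.iUnion_eq.ge (mem_univ x))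
    obtain ⟨U, hU, hxU⟩ := exists_compact_mem_nhds x
    refine ⟨U ∩ interior (K (m + 1)),
      Filter.inter_mem hxU (isOpen_interior.mem_nhds (K.subset_interior_succ m hm)), ?_⟩
    have hfin : (⋃ n ∈ {n | n < m + 3}, (fun γ : Γ => (n, γ)) ''
        {γ : Γ | ((γ • ·) '' U ∩ S n).Nonempty}).Finite :=
      (Set.finite_lt_nat (m + 3)).biUnion fun n _ =>
        (ProperlyDiscontinuousSMul.finite_disjoint_inter_image hU (hS n)).image _
    refine hfin.subset ?_
    rintro ⟨n, γ⟩ ⟨y, hy, hyU, hyK⟩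
    have hsupp := h4 n (Function.mem_support.2 hy)
    -- Since `y ∈ K (m + 1)`, all translates of `y` lie in `Z n` as soon as `m + 2 < n`, and `φ n`
    -- vanishes on `Z n`.
    have hn : n < m + 3 := by
      by_contra hn
      refine hsupp.2 (mem_iUnion₂.2 ⟨m + 1, ?_, γ⁻¹, ?_⟩)
      · show m + 1 + 1 < n
        omega
      · simpa using interior_subset hyK
    exact mem_iUnion₂.2 ⟨n, hn, γ, ⟨γ • y, ⟨y, hyU, rfl⟩, hsupp.1⟩, rfl⟩

end Cutoff

/-! ### Smooth vector fields on the product of the manifold with a vector space -/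

section Fields

variable {d : ℕ} {M : Type*} [TopologicalSpace M] [ChartedSpace (EuclideanSpace ℝ (Fin d)) M]
  [IsManifold (𝓡 d) ∞ M] {Q : Type*} [NormedAddCommGroup Q] [NormedSpace ℝ Q]
  {E' H' : Type*} [NormedAddCommGroup E'] [NormedSpace ℝ E'] [TopologicalSpace H']
  {J : ModelWithCorners ℝ E' H'} {S : Type*} [TopologicalSpace S] [ChartedSpace H' S]

/-- Smoothness at a point of a vector field on `M × Q`. -/
def SmoothFieldAt (X : M × Q → EuclideanSpace ℝ (Fin d) × Q) (y : M × Q) : Prop :=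
  ContMDiffAt ((𝓡 d).prod 𝓘(ℝ, Q)) ((𝓡 d).prod 𝓘(ℝ, Q)).tangent ∞
    (fun z => (⟨z, X z⟩ : TangentBundle ((𝓡 d).prod 𝓘(ℝ, Q)) (M × Q))) y

theorem smoothFieldAt_iff {X : M × Q → EuclideanSpace ℝ (Fin d) × Q} {y : M × Q} :
    SmoothFieldAt X y ↔
      ContMDiffAt ((𝓡 d).prod 𝓘(ℝ, Q)) (𝓡 d).tangent ∞
        (fun z => (⟨z.1, (X z).1⟩ : TangentBundle (𝓡 d) M)) y ∧
      ContMDiffAt ((𝓡 d).prod 𝓘(ℝ, Q)) 𝓘(ℝ, Q) ∞ (fun z => (X z).2) y := by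
  have hM : IsManifold (𝓡 d) 1 M := IsManifold.of_le (n := ∞) (by simp)
  constructor
  · intro h
    have h1 := (contMDiff_equivTangentBundleProd (n := ∞) (I := 𝓡 d) (M := M) (I' := 𝓘(ℝ, Q))
      (M' := Q)).contMDiffAt.comp y h
    exact ⟨contMDiffAt_fst.comp y h1, (contMDiff_snd_tangentBundle_modelSpace Q
      𝓘(ℝ, Q)).contMDiffAt.comp y (contMDiffAt_snd.comp y h1)⟩
  · rintro ⟨h1, h2⟩
    have h3 : ContMDiffAt ((𝓡 d).prod 𝓘(ℝ, Q)) 𝓘(ℝ, Q).tangent ∞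
        (fun z : M × Q => (⟨z.2, (X z).2⟩ : TangentBundle 𝓘(ℝ, Q) Q)) y := by
      rw [Bundle.contMDiffAt_totalSpace]
      refine ⟨contMDiffAt_snd, ?_⟩
      convert! h2 with z
      simp
    exact (contMDiff_equivTangentBundleProd_symm (n := ∞) (I := 𝓡 d) (M := M) (I' := 𝓘(ℝ, Q))
      (M' := Q)).contMDiffAt.comp y (h1.prodMk h3)

/-- The derivative of a smooth function on an open set along a smoothly varying tangent vector. -/
theorem contMDiffAt_mfderiv_apply {F : Type*} [NormedAddCommGroup F] [NormedSpace ℝ F]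
    {f : M → F} {s : Set M} (hs : IsOpen s)
    (hf : ∀ x ∈ s, ContMDiffAt (𝓡 d) 𝓘(ℝ, F) ∞ f x) {b : S → M} {v : S → EuclideanSpace ℝ (Fin d)}
    {y : S} (hy : b y ∈ s)
    (hv : ContMDiffAt J (𝓡 d).tangent ∞ (fun z => (⟨b z, v z⟩ : TangentBundle (𝓡 d) M)) y) :
    ContMDiffAt J 𝓘(ℝ, F) ∞ (fun z => (mfderiv (𝓡 d) 𝓘(ℝ, F) f (b z) (v z) : F)) y := by
  have hM : IsManifold (𝓡 d) 1 M := IsManifold.of_le (n := ∞) (by simp)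
  have h1 : ContMDiffOn (𝓡 d) 𝓘(ℝ, F) ∞ f s := fun x hx => (hf x hx).contMDiffWithinAt
  have h2 := h1.contMDiffOn_tangentMapWithin (m := ∞) (by simp) hs.uniqueMDiffOn
  have hb : ContinuousAt b y := by
    have := (Bundle.contMDiffAt_totalSpace.1 hv).1
    exact this.continuousAt
  have hev : ∀ᶠ z in 𝓝 y, b z ∈ s := hb.eventually (hs.mem_nhds hy)
  have hopen : IsOpen (Bundle.TotalSpace.proj ⁻¹' s : Set (TangentBundle (𝓡 d) M)) :=
    hs.preimage (FiberBundle.continuous_proj _ _)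
  have h3 := (h2.contMDiffAt (x := ⟨b y, v y⟩) (hopen.mem_nhds hy)).comp y hv
  have h4 := (contMDiff_snd_tangentBundle_modelSpace (n := ∞) F 𝓘(ℝ, F)).contMDiffAt.comp y h3
  refine h4.congr_of_eventuallyEq ?_
  filter_upwards [hev] with z hz
  have := tangentMapWithin_eq_tangentMap (I := 𝓡 d) (I' := 𝓘(ℝ, F)) (f := f)
    (p := ⟨b z, v z⟩) (hs.uniqueMDiffOn _ hz)
    ((hf _ hz).mdifferentiableAt (by simp))
  change _ = (tangentMapWithin (𝓡 d) 𝓘(ℝ, F) f s ⟨b z, v z⟩).2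
  rw [this]
  rfl

end Fields

/-! ### Tangency to the tautological bundle -/

section Tangency

theorem HasMFDerivAt.clm_apply_vector {E' H' : Type*} [NormedAddCommGroup E'] [NormedSpace ℝ E']
    [TopologicalSpace H'] {J : ModelWithCorners ℝ E' H'} {S : Type*} [TopologicalSpace S]
    [ChartedSpace H' S] {F G : Type*} [NormedAddCommGroup F] [NormedSpace ℝ F]
    [NormedAddCommGroup G] [NormedSpace ℝ G] {A : S → F →L[ℝ] G} {b : S → F} {x : S}
    {A' : E' →L[ℝ] (F →L[ℝ] G)} {b' : E' →L[ℝ] F}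
    (hA : HasMFDerivAt J 𝓘(ℝ, F →L[ℝ] G) A x A') (hb : HasMFDerivAt J 𝓘(ℝ, F) b x b') :
    HasMFDerivAt J 𝓘(ℝ, G) (fun y => A y (b y)) x ((A x).comp b' + A'.flip (b x) : E' →L[ℝ] G) :=
  ⟨hA.1.clm_apply hb.1, by
    have h := HasFDerivWithinAt.clm_apply hA.2 hb.2
    simp only [mfld_simps] at h
    exact h⟩

variable {E : Type*} [NormedAddCommGroup E] [NormedSpace ℝ E] [FiniteDimensional ℝ E]
  {d k : ℕ} {M : Type*} [TopologicalSpace M] [ChartedSpace (EuclideanSpace ℝ (Fin d)) M]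
  {u : M → Gr k E}

theorem IsSmooth.hasMFDerivAt_projAlong (hu : IsSmooth (d := d) u) {x : M} {H : Submodule ℝ E}
    (h : IsCompl (u x).1 H) :
    HasMFDerivAt (𝓡 d) 𝓘(ℝ, E →L[ℝ] E) (fun y => projAlong H (u y).1) x (projDeriv u H x) :=
  ((hu.contMDiffAt_projAlong h).mdifferentiableAt (by simp)).hasMFDerivAt

/-- A tangent vector `(v, w)` at `(x, q)` is tangent to the tautological bundle. -/
def IsTangentAt (u : M → Gr k E) (y : M × E) (z : EuclideanSpace ℝ (Fin d) × E) : Prop :=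
  ∀ H, IsCompl (u y.1).1 H → z.2 - projDeriv u H y.1 z.1 y.2 ∈ (u y.1).1

/-- Differentiating `P_H (y) (s y) = s y` for `s y ∈ u y`. -/
theorem IsSmooth.sub_projDeriv_mem (hu : IsSmooth (d := d) u) {x : M} {H : Submodule ℝ E}
    (h : IsCompl (u x).1 H) {s : M → E} {s' : EuclideanSpace ℝ (Fin d) →L[ℝ] E}
    (hs : HasMFDerivAt (𝓡 d) 𝓘(ℝ, E) s x s') (hmem : ∀ᶠ y in 𝓝 x, s y ∈ (u y).1)
    (v : EuclideanSpace ℝ (Fin d)) : s' v - projDeriv u H x v (s x) ∈ (u x).1 := by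
  have h1 := HasMFDerivAt.clm_apply_vector (hu.hasMFDerivAt_projAlong h) hs
  have h2 : s =ᶠ[𝓝 x] fun y => projAlong H (u y).1 (s y) := by
    filter_upwards [hmem, (hu x H h).1] with y hy hy'
    exact (projAlong_of_mem hy' hy).symm
  have h3 := hasMFDerivAt_unique hs (h1.congr_of_eventuallyEq h2)
  have h4 : s' v = projAlong H (u x).1 (s' v) + projDeriv u H x v (s x) :=
    congrArg (fun L : EuclideanSpace ℝ (Fin d) →L[ℝ] E => L v) h3
  have h5 : s' v - projDeriv u H x v (s x) = projAlong H (u x).1 (s' v) :=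
    sub_eq_of_eq_add h4
  rw [h5]
  exact projAlong_mem h _

/-- One complement suffices: `y ↦ P_H(y) q` is a section of the bundle through `q`, so its
derivative satisfies the tangency condition for every other complement `H'`; adding the two
memberships replaces `H` by `H'`. -/
theorem IsSmooth.isTangentAt_iff (hu : IsSmooth (d := d) u) {x : M} {H : Submodule ℝ E}
    (h : IsCompl (u x).1 H) {q : E} (hq : q ∈ (u x).1) {z : EuclideanSpace ℝ (Fin d) × E} :
    IsTangentAt u (x, q) z ↔ z.2 - projDeriv u H x z.1 q ∈ (u x).1 := by
  refine ⟨fun h' => h' H h, fun hz H' h' => ?_⟩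
  let D : EuclideanSpace ℝ (Fin d) →L[ℝ] E →L[ℝ] E := projDeriv u H x
  let s' : EuclideanSpace ℝ (Fin d) →L[ℝ] E := D.flip q
  have hs : HasMFDerivAt (𝓡 d) 𝓘(ℝ, E) (fun y => projAlong H (u y).1 q) x s' := by
    have := HasMFDerivAt.clm_apply_vector (hu.hasMFDerivAt_projAlong h)
      (hasMFDerivAt_const (I := 𝓡 d) (I' := 𝓘(ℝ, E)) q x)
    refine this.congr_mfderiv ?_
    change (projAlong H (u x).1).comp (0 : EuclideanSpace ℝ (Fin d) →L[ℝ] E) + s' = s'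
    simp
  have h1 := hu.sub_projDeriv_mem h' hs
    ((hu x H h).1.mono fun y hy => projAlong_mem hy q) z.1
  rw [projAlong_of_mem h hq] at h1
  have h2 := (u x).1.add_mem hz h1
  have h3 : s' z.1 = projDeriv u H x z.1 q := rfl
  rwa [h3, sub_add_sub_cancel] at h2

theorem IsTangentAt.add {y : M × E} {z z' : EuclideanSpace ℝ (Fin d) × E}
    (h : IsTangentAt u y z) (h' : IsTangentAt u y z') : IsTangentAt u y (z + z') := by
  intro H hH
  have := (u y.1).1.add_mem (h H hH) (h' H hH)
  convert! this using 1
  have h1 : projDeriv u H y.1 (z.1 + z'.1) = projDeriv u H y.1 z.1 + projDeriv u H y.1 z'.1 :=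
    map_add (projDeriv u H y.1) _ _
  rw [Prod.fst_add, Prod.snd_add, h1, add_apply]
  abel

theorem IsTangentAt.smul {y : M × E} {z : EuclideanSpace ℝ (Fin d) × E}
    (h : IsTangentAt u y z) (c : ℝ) : IsTangentAt u y (c • z) := by
  intro H hH
  have := (u y.1).1.smul_mem c (h H hH)
  convert! this using 1
  have h1 : projDeriv u H y.1 (c • z.1) = c • projDeriv u H y.1 z.1 :=
    map_smul (projDeriv u H y.1) _ _
  rw [Prod.smul_fst, Prod.smul_snd, h1, smul_apply, smul_sub]

theorem isTangentAt_zero (y : M × E) :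
    IsTangentAt u y (0 : EuclideanSpace ℝ (Fin d) × E) := by
  intro H _
  have h1 : projDeriv u H y.1 (0 : EuclideanSpace ℝ (Fin d)) = 0 := map_zero (projDeriv u H y.1)
  rw [Prod.fst_zero, Prod.snd_zero, h1]
  simp

end Tangency

/-! ### Positive tangent fields, locally and on closed sets -/

section LocalField

variable {V : Type*} [NormedAddCommGroup V] [NormedSpace ℝ V] [FiniteDimensional ℝ V]
  {d : ℕ} {M : Type*} [TopologicalSpace M] [ChartedSpace (EuclideanSpace ℝ (Fin d)) M]
  {u : M → Gr d (Quadric V)}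

/-- The derivative pairing between tangent vectors and elements of the fibre has a positive value
for every nonzero element of the fibre. -/
theorem IsFittingImmersion.exists_pos (hu : IsFittingImmersion u) {x : M}
    {H : Submodule ℝ (Quadric V)} (h : IsCompl (u x).1 H) {q : Quadric V} (hq : q ∈ (u x).1)
    (hq0 : q ≠ 0) :
    ∃ v : EuclideanSpace ℝ (Fin d), ∃ w ∈ (u x).1, (projDeriv u H x v q + w).Pos := by
  let D : EuclideanSpace ℝ (Fin d) →L[ℝ] Quadric V →L[ℝ] Quadric V := projDeriv u H x
  let β : EuclideanSpace ℝ (Fin d) →ₗ[ℝ] Quadric V →ₗ[ℝ] Quadric V :=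
    (ContinuousLinearMap.coeLM ℝ).comp D.toLinearMap
  have hdim : Module.finrank ℝ (EuclideanSpace ℝ (Fin d)) = Module.finrank ℝ (u x).1 := by
    rw [(u x).2]; simp
  refine exists_mem_cone_of_fitting hdim β (C := {q : Quadric V | q.Pos}) isOpen_pos convex_pos
    ?_ hq hq0
  intro v hv
  obtain ⟨p, c, hc, hpc⟩ := hu.fitting x H h v hv
  have hpc := (hu.smooth.mkQ_projDeriv h v p).trans hpc
  refine ⟨p, p.2, c - D v p, ?_, ?_⟩
  · exact (Submodule.Quotient.eq _).1 hpc.symm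
  · change (D v p + (c - D v p)).Pos
    rwa [add_sub_cancel]

variable [IsManifold (𝓡 d) ∞ M]

/-- Take `v` and `w` from `exists_pos`, extend `v` to a local field on `M` and move `w` into nearby
fibres by the projection. The resulting second component is the derivative of the projection applied
to `q`, plus a vector of the fibre: this is tangency. Positivity persists near `(x, q)` since the
cone is open. -/
theorem IsFittingImmersion.exists_local_field (hu : IsFittingImmersion u) {x : M} {q : Quadric V}
    (hq : q ∈ (u x).1) (hq0 : q ≠ 0) :
    ∃ X : M × Quadric V → EuclideanSpace ℝ (Fin d) × Quadric V, ∃ U ∈ 𝓝 (x, q), ∀ y ∈ U,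
      SmoothFieldAt X y ∧ (X y).2.Pos ∧ (y.2 ∈ (u y.1).1 → IsTangentAt u y (X y)) := by
  obtain ⟨H, hH⟩ := Submodule.exists_isCompl (u x).1
  obtain ⟨v, w, hw, hpos⟩ := hu.exists_pos hH hq hq0
  let v' : TangentSpace (𝓡 d) x := v
  let vl : M → EuclideanSpace ℝ (Fin d) :=
    fun y => FiberBundle.extend (E := fun y : M => TangentSpace (𝓡 d) y)
      (EuclideanSpace ℝ (Fin d)) v' y
  have hvl : vl x = v := FiberBundle.extend_apply_self _ _
  obtain ⟨s, hs, hsv⟩ := FiberBundle.exists_contMDiffOn_extend (𝓡 d) (k := ∞)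
    (V := fun y : M => TangentSpace (𝓡 d) y) (EuclideanSpace ℝ (Fin d)) v'
  obtain ⟨s', hs's, hs'o, hxs'⟩ := mem_nhds_iff.1 hs
  have hUo := hu.smooth.isOpen_isCompl H
  let X : M × Quadric V → EuclideanSpace ℝ (Fin d) × Quadric V := fun y =>
    (vl y.1, projDeriv u H y.1 (vl y.1) y.2 + projAlong H (u y.1).1 w)
  have hX : ∀ y : M × Quadric V, y.1 ∈ s' ∩ {x | IsCompl (u x).1 H} → SmoothFieldAt X y := by
    rintro y ⟨hy1, hy2⟩
    have h1 : ContMDiffAt ((𝓡 d).prod 𝓘(ℝ, Quadric V)) (𝓡 d).tangent ∞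
        (fun z : M × Quadric V => (⟨z.1, vl z.1⟩ : TangentBundle (𝓡 d) M)) y :=
      ContMDiffAt.comp (g := fun z : M => (⟨z, vl z⟩ : TangentBundle (𝓡 d) M)) y
        (hsv.contMDiffAt (Filter.mem_of_superset (hs'o.mem_nhds hy1) hs's)) contMDiffAt_fst
    refine smoothFieldAt_iff.2 ⟨h1, ?_⟩
    have h2 := contMDiffAt_mfderiv_apply hUo (fun x hx => hu.smooth.contMDiffAt_projAlong hx)
      (b := fun z : M × Quadric V => z.1) (v := fun z => vl z.1) hy2 h1
    have h3 : ContMDiffAt ((𝓡 d).prod 𝓘(ℝ, Quadric V)) 𝓘(ℝ, Quadric V →L[ℝ] Quadric V) ∞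
        (fun z : M × Quadric V => projAlong H (u z.1).1) y :=
      ContMDiffAt.comp (g := fun z => projAlong H (u z).1) y
        (hu.smooth.contMDiffAt_projAlong hy2) contMDiffAt_fst
    exact (h2.clm_apply contMDiffAt_snd).add (h3.clm_apply contMDiffAt_const)
  have hx : x ∈ s' ∩ {x | IsCompl (u x).1 H} := ⟨hxs', hH⟩
  have hposev : ∀ᶠ y in 𝓝 (x, q), (X y).2.Pos := by
    refine (smoothFieldAt_iff.1 (hX (x, q) hx)).2.continuousAt.eventually
      (isOpen_pos.mem_nhds ?_)
    change (projDeriv u H x (vl x) q + projAlong H (u x).1 w).Pos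
    rw [hvl, projAlong_of_mem hH hw]
    exact hpos
  have hev : ∀ᶠ y : M × Quadric V in 𝓝 (x, q), y.1 ∈ s' ∩ {x | IsCompl (u x).1 H} :=
    continuousAt_fst.eventually ((hs'o.inter hUo).mem_nhds hx)
  refine ⟨X, _, hposev.and hev, fun y hy => ⟨hX y hy.2, hy.1, fun hmem => ?_⟩⟩
  refine (hu.smooth.isTangentAt_iff hy.2.2 hmem).2 ?_
  change projDeriv u H y.1 (vl y.1) y.2 + projAlong H (u y.1).1 w -
    projDeriv u H y.1 (vl y.1) y.2 ∈ (u y.1).1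
  rw [add_sub_cancel_left]
  exact projAlong_mem hy.2.2 w

variable [T2Space M] [SecondCountableTopology M]

/-- Positivity and tangency are convex and imposed only on `Z`, so a partition of unity glues the
local fields with the zero field on the complement of `Z`. -/
theorem IsFittingImmersion.exists_field_on_closed (hu : IsFittingImmersion u)
    {Z : Set (M × Quadric V)} (hZ : IsClosed Z) (hZu : ∀ y ∈ Z, y.2 ∈ (u y.1).1 ∧ y.2 ≠ 0) :
    ∃ X : M × Quadric V → EuclideanSpace ℝ (Fin d) × Quadric V, (∀ y, SmoothFieldAt X y) ∧
      ∀ y ∈ Z, (X y).2.Pos ∧ IsTangentAt u y (X y) := by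
  have : LocallyCompactSpace M := ChartedSpace.locallyCompactSpace (EuclideanSpace ℝ (Fin d)) M
  have : ProperSpace (Quadric V) := FiniteDimensional.proper ℝ (Quadric V)
  let t : ∀ y : M × Quadric V, Set (TangentSpace ((𝓡 d).prod 𝓘(ℝ, Quadric V)) y) := fun y =>
    {z : EuclideanSpace ℝ (Fin d) × Quadric V | y ∈ Z → z.2.Pos ∧ IsTangentAt u y z}
  have ht : ∀ y, Convex ℝ (t y) := by
    intro y
    rw [convex_iff_forall_pos]
    intro z hz z' hz' a b ha hb _ hy
    exact ⟨((hz hy).1.smul ha).add ((hz' hy).1.smul hb),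
      ((hz hy).2.smul a).add ((hz' hy).2.smul b)⟩
  obtain ⟨X, hX⟩ := exists_contMDiffSection_forall_mem_convex_of_local (n := ⊤)
    ((𝓡 d).prod 𝓘(ℝ, Quadric V)) (fun y => TangentSpace ((𝓡 d).prod 𝓘(ℝ, Quadric V)) y) t ht (by
      intro y
      by_cases hy : y ∈ Z
      · obtain ⟨X, U, hU, h⟩ := hu.exists_local_field (hZu y hy).1 (hZu y hy).2
        exact ⟨U, hU, X, fun z hz => (h z hz).1.contMDiffWithinAt,
          fun z hz hzZ => ⟨(h z hz).2.1, (h z hz).2.2 (hZu z hzZ).1⟩⟩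
      · refine ⟨Zᶜ, hZ.isOpen_compl.mem_nhds hy, fun _ => 0, ?_, fun z hz hzZ => absurd hzZ hz⟩
        exact (Bundle.contMDiff_zeroSection ℝ _).contMDiffOn)
  exact ⟨X, fun y => X.contMDiff y, fun y hy => hX y hy⟩

end LocalField

/-! ### A smooth norm and scaling -/

section Homogeneous

variable {E : Type*} [NormedAddCommGroup E] [NormedSpace ℝ E] [FiniteDimensional ℝ E]

/-- A norm that is smooth away from the origin. -/
noncomputable def euclideanNorm (q : E) : ℝ := ‖toEuclidean q‖

theorem euclideanNorm_smul {c : ℝ} (hc : 0 < c) (q : E) :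
    euclideanNorm (c • q) = c * euclideanNorm q := by
  simp [euclideanNorm, norm_smul, abs_of_pos hc]

theorem euclideanNorm_pos {q : E} (hq : q ≠ 0) : 0 < euclideanNorm q := by
  simpa [euclideanNorm] using hq

theorem continuous_euclideanNorm : Continuous (euclideanNorm : E → ℝ) :=
  continuous_norm.comp toEuclidean.continuous

theorem contDiffAt_euclideanNorm {q : E} (hq : q ≠ 0) {n : WithTop ℕ∞} :
    ContDiffAt ℝ n (euclideanNorm : E → ℝ) q :=
  (contDiffAt_norm ℝ (by simpa using hq)).comp q toEuclidean.contDiff.contDiffAt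

theorem euclideanNorm_normalize {q : E} (hq : q ≠ 0) :
    euclideanNorm ((euclideanNorm q)⁻¹ • q) = 1 := by
  rw [euclideanNorm_smul (inv_pos.2 (euclideanNorm_pos hq)),
    inv_mul_cancel₀ (euclideanNorm_pos hq).ne']

theorem ne_zero_of_euclideanNorm_eq_one {q : E} (hq : euclideanNorm q = 1) : q ≠ 0 := by
  rintro rfl
  simp [euclideanNorm] at hq

theorem isCompact_euclideanSphere : IsCompact {q : E | euclideanNorm q = 1} := by
  have : {q : E | euclideanNorm q = 1} = toEuclidean ⁻¹' Metric.sphere 0 1 := by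
    ext q; simp [euclideanNorm]
  rw [this]
  exact toEuclidean.toHomeomorph.isCompact_preimage.2 (isCompact_sphere _ _)

variable {d k : ℕ} {M : Type*} [TopologicalSpace M] [ChartedSpace (EuclideanSpace ℝ (Fin d)) M]
  {u : M → Gr k E}

theorem IsTangentAt.scale {x : M} {q : E} {z : EuclideanSpace ℝ (Fin d) × E}
    (h : IsTangentAt u (x, q) z) (c : ℝ) : IsTangentAt u (x, c • q) (z.1, c • z.2) := by
  intro H hH
  have := (u x).1.smul_mem c (h H hH)
  simpa [smul_sub] using this

end Homogeneous

/-! ### Transport of fields and tangency by the group -/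

section Averaging

variable {V : Type*} [NormedAddCommGroup V] [NormedSpace ℝ V] [FiniteDimensional ℝ V]
  {d : ℕ} {M : Type*} [TopologicalSpace M] [ChartedSpace (EuclideanSpace ℝ (Fin d)) M]
  {u : M → Gr d (Quadric V)}

/-- The derivative of the action of `γ` on `M × 𝒬`, as a linear map. -/
noncomputable def actDeriv {Γ : Type*} [Group Γ] [MulAction Γ M] (ρ : Γ →* SpecialLinearGroup ℝ V)
    (γ : Γ) (x : M) :
    EuclideanSpace ℝ (Fin d) × Quadric V →ₗ[ℝ] EuclideanSpace ℝ (Fin d) × Quadric V :=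
  let D : EuclideanSpace ℝ (Fin d) →L[ℝ] EuclideanSpace ℝ (Fin d) :=
    mfderiv (𝓡 d) (𝓡 d) (fun y : M => γ • y) x
  D.toLinearMap.prodMap (quadricAct (ρ γ))

/-- The action of `γ` on `M × 𝒬`. -/
noncomputable def actTotal {Γ : Type*} [Group Γ] [MulAction Γ M] (ρ : Γ →* SpecialLinearGroup ℝ V)
    (γ : Γ) (y : M × Quadric V) : M × Quadric V := (γ • y.1, quadricAct (ρ γ) y.2)

variable {Γ : Type*} [Group Γ] [MulAction Γ M] {ρ : Γ →* SpecialLinearGroup ℝ V}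

theorem actDeriv_comp (hsm : ∀ γ : Γ, ContMDiff (𝓡 d) (𝓡 d) ∞ (fun x : M => γ • x))
    (γ δ : Γ) (x : M) (z : EuclideanSpace ℝ (Fin d) × Quadric V) :
    actDeriv ρ γ (δ • x) (actDeriv ρ δ x z) = actDeriv ρ (γ * δ) x z := by
  have h1 : mfderiv (𝓡 d) (𝓡 d) (fun y : M => (γ * δ) • y) x =
      (mfderiv (𝓡 d) (𝓡 d) (fun y : M => γ • y) (δ • x)).comp
        (mfderiv (𝓡 d) (𝓡 d) (fun y : M => δ • y) x) := by
    rw [← mfderiv_comp x ((hsm γ).mdifferentiableAt (by simp))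
      ((hsm δ).mdifferentiableAt (by simp))]
    congr 1
    funext y
    exact mul_smul γ δ y
  refine Prod.ext ?_ ?_
  · exact (congrArg (fun L : EuclideanSpace ℝ (Fin d) →L[ℝ] EuclideanSpace ℝ (Fin d) => L z.1)
      h1).symm
  · change quadricAct (ρ γ) (quadricAct (ρ δ) z.2) = quadricAct (ρ (γ * δ)) z.2
    rw [map_mul, quadricAct_mul_apply]

/-- Differentiate in `y` the identity between `P(γ y) ∘ ρ(γ)` and `ρ(γ) ∘ P(y)`, where the
projections are along `ρ(γ) H` and `H`. -/
theorem IsTangentAt.act (hu : IsSmooth (d := d) u) (hρ : IsEquivariant ρ u)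
    (hsm : ∀ γ : Γ, ContMDiff (𝓡 d) (𝓡 d) ∞ (fun x : M => γ • x)) (γ : Γ) {x : M} {q : Quadric V}
    (hq : q ∈ (u x).1) {z : EuclideanSpace ℝ (Fin d) × Quadric V} (h : IsTangentAt u (x, q) z) :
    IsTangentAt u (actTotal ρ γ (x, q)) (actDeriv ρ γ x z) := by
  obtain ⟨H, hH⟩ := Submodule.exists_isCompl (u x).1
  have hgH := (hρ.projAlong_smul γ hH 0).1
  have hgq : quadricAct (ρ γ) q ∈ (u (γ • x)).1 := by
    rw [hρ γ x]; exact Submodule.mem_map_of_mem hq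
  refine (hu.isTangentAt_iff hgH hgq).2 ?_
  let g : Quadric V →L[ℝ] Quadric V := LinearMap.toContinuousLinearMap (quadricAct (ρ γ))
  have h1 : HasMFDerivAt (𝓡 d) 𝓘(ℝ, Quadric V →L[ℝ] Quadric V)
      (fun y => (projAlong (H.map (quadricAct (ρ γ))) (u (γ • y)).1)) x
      ((projDeriv u (H.map (quadricAct (ρ γ))) (γ • x)).comp
        (mfderiv (𝓡 d) (𝓡 d) (fun y : M => γ • y) x)) :=
    HasMFDerivAt.comp x (hu.hasMFDerivAt_projAlong hgH)
      ((hsm γ).mdifferentiableAt (by simp)).hasMFDerivAt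
  let L₁ : (Quadric V →L[ℝ] Quadric V) →L[ℝ] (Quadric V →L[ℝ] Quadric V) :=
    (ContinuousLinearMap.compL ℝ (Quadric V) (Quadric V) (Quadric V)).flip g
  let L₂ : (Quadric V →L[ℝ] Quadric V) →L[ℝ] (Quadric V →L[ℝ] Quadric V) :=
    ContinuousLinearMap.compL ℝ (Quadric V) (Quadric V) (Quadric V) g
  have h2 := HasMFDerivAt.comp x (L₁.hasFDerivAt.hasMFDerivAt) h1
  have h3 := HasMFDerivAt.comp x (L₂.hasFDerivAt.hasMFDerivAt) (hu.hasMFDerivAt_projAlong hH)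
  have heq : (fun y => L₁ (projAlong (H.map (quadricAct (ρ γ))) (u (γ • y)).1)) =ᶠ[𝓝 x]
      fun y => L₂ (projAlong H (u y).1) := by
    filter_upwards [(hu x H hH).1] with y hy
    ext1 r
    exact (hρ.projAlong_smul γ hy r).2
  have h4 := hasMFDerivAt_unique h2 (h3.congr_of_eventuallyEq heq)
  have h5 : projDeriv u (H.map (quadricAct (ρ γ))) (γ • x) (actDeriv ρ γ x z).1
      (quadricAct (ρ γ) q) = quadricAct (ρ γ) (projDeriv u H x z.1 q) :=
    congrArg (fun L : EuclideanSpace ℝ (Fin d) →L[ℝ] (Quadric V →L[ℝ] Quadric V) => L z.1 q) h4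
  change (actDeriv ρ γ x z).2 - projDeriv u (H.map (quadricAct (ρ γ))) (γ • x)
    (actDeriv ρ γ x z).1 (quadricAct (ρ γ) q) ∈ (u (γ • x)).1
  rw [h5, hρ γ x]
  change quadricAct (ρ γ) z.2 - _ ∈ _
  rw [← map_sub]
  exact Submodule.mem_map_of_mem (h H hH)

variable [IsManifold (𝓡 d) ∞ M]

theorem SmoothFieldAt.pullback (hsm : ∀ γ : Γ, ContMDiff (𝓡 d) (𝓡 d) ∞ (fun x : M => γ • x))
    (γ : Γ) {X : M × Quadric V → EuclideanSpace ℝ (Fin d) × Quadric V} {y : M × Quadric V}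
    (h : SmoothFieldAt X (actTotal ρ γ y)) :
    SmoothFieldAt (fun z => actDeriv ρ γ⁻¹ (γ • z.1) (X (actTotal ρ γ z))) y := by
  have hM : IsManifold (𝓡 d) 1 M := IsManifold.of_le (n := ∞) (by simp)
  obtain ⟨h1, h2⟩ := smoothFieldAt_iff.1 h
  let g : Quadric V →L[ℝ] Quadric V := LinearMap.toContinuousLinearMap (quadricAct (ρ γ))
  let g' : Quadric V →L[ℝ] Quadric V := LinearMap.toContinuousLinearMap (quadricAct (ρ γ⁻¹))
  have hact : ContMDiffAt ((𝓡 d).prod 𝓘(ℝ, Quadric V)) ((𝓡 d).prod 𝓘(ℝ, Quadric V)) ∞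
      (actTotal ρ γ : M × Quadric V → M × Quadric V) y :=
    (((hsm γ).contMDiffAt).comp y contMDiffAt_fst).prodMk
      (g.contDiff.contMDiff.contMDiffAt.comp y contMDiffAt_snd)
  refine smoothFieldAt_iff.2 ⟨?_, g'.contDiff.contMDiff.contMDiffAt.comp y (h2.comp y hact)⟩
  have h3 := ((hsm γ⁻¹).contMDiff_tangentMap (m := ∞) (by simp)).contMDiffAt.comp y (h1.comp y hact)
  refine h3.congr_of_eventuallyEq (Filter.Eventually.of_forall fun z => ?_)
  -- The tangent map lands over `γ⁻¹ • γ • z.1`, equal to `z.1` only propositionally; the model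
  -- fibre is the same.
  have hcast : ∀ (a b : M) (_ : a = b) (v : EuclideanSpace ℝ (Fin d)),
      (⟨a, v⟩ : TangentBundle (𝓡 d) M) = ⟨b, v⟩ := by
    rintro a _ rfl v; rfl
  exact hcast _ _ (inv_smul_smul γ z.1).symm _

end Averaging

/-! ### Homogeneous positive fields and their averages -/

section GlobalField

variable {V : Type*} [NormedAddCommGroup V] [NormedSpace ℝ V] [FiniteDimensional ℝ V]
  {d : ℕ} {M : Type*} [TopologicalSpace M]
  [ChartedSpace (EuclideanSpace ℝ (Fin d)) M] [IsManifold (𝓡 d) ∞ M]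
  {u : M → Gr d (Quadric V)}

/-- A smooth, positive, tangent and homogeneous vector field away from the zero section. -/
structure IsPositiveField (u : M → Gr d (Quadric V))
    (X : M × Quadric V → EuclideanSpace ℝ (Fin d) × Quadric V) : Prop where
  smooth : ∀ y : M × Quadric V, y.2 ≠ 0 → SmoothFieldAt X y
  pos : ∀ y : M × Quadric V, y.2 ∈ (u y.1).1 → y.2 ≠ 0 → (X y).2.Pos
  tangent : ∀ y : M × Quadric V, y.2 ∈ (u y.1).1 → y.2 ≠ 0 → IsTangentAt u y (X y)
  homogeneous : ∀ (x : M) (q : Quadric V) (c : ℝ), 0 < c →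
    X (x, c • q) = ((X (x, q)).1, c • (X (x, q)).2)

variable {Γ : Type*} [Group Γ] [MulAction Γ M] {ρ : Γ →* SpecialLinearGroup ℝ V}

/-- Averaging a positive field over the group, with the help of cutoff functions. -/
theorem IsPositiveField.exists_equivariant (hu : IsSmooth (d := d) u) (hρ : IsEquivariant ρ u)
    (hsm : ∀ γ : Γ, ContMDiff (𝓡 d) (𝓡 d) ∞ (fun x : M => γ • x))
    {φ : ℕ → M → ℝ} (hφs : ∀ n, ContMDiff (𝓡 d) 𝓘(ℝ, ℝ) ∞ (φ n)) (hφ0 : ∀ n x, 0 ≤ φ n x)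
    (hφ1 : ∀ x, ∃ n, ∃ γ : Γ, 0 < φ n (γ • x))
    (hφf : LocallyFinite (fun i : ℕ × Γ => {x : M | φ i.1 (i.2 • x) ≠ 0}))
    {X : M × Quadric V → EuclideanSpace ℝ (Fin d) × Quadric V} (hX : IsPositiveField u X) :
    ∃ Y, IsPositiveField u Y ∧ ∀ (γ : Γ) y, Y (actTotal ρ γ y) = actDeriv ρ γ y.1 (Y y) := by
  -- The term of index `(n, γ)` is the pullback of `X` by `γ`, weighted by `φ n` at the translated
  -- point.
  let T : ℕ × Γ → M × Quadric V → EuclideanSpace ℝ (Fin d) × Quadric V := fun i y =>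
    φ i.1 (i.2 • y.1) • actDeriv ρ i.2⁻¹ (i.2 • y.1) (X (actTotal ρ i.2 y))
  have hfin : ∀ y : M × Quadric V, {i : ℕ × Γ | φ i.1 (i.2 • y.1) ≠ 0}.Finite := fun y =>
    hφf.point_finite y.1
  have hTfin : ∀ y, (Function.support fun i => T i y).Finite := fun y =>
    (hfin y).subset fun i hi h => hi (by simp [T, h])
  have hmem : ∀ (γ : Γ) (y : M × Quadric V), y.2 ∈ (u y.1).1 →
      (actTotal ρ γ y).2 ∈ (u (actTotal ρ γ y).1).1 := fun γ y hy => by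
    change quadricAct (ρ γ) y.2 ∈ (u (γ • y.1)).1
    rw [hρ γ y.1]; exact Submodule.mem_map_of_mem hy
  have hne : ∀ (γ : Γ) (y : M × Quadric V), y.2 ≠ 0 → (actTotal ρ γ y).2 ≠ 0 := fun γ y hy =>
    quadricAct_ne_zero _ hy
  have hback : ∀ (γ : Γ) (y : M × Quadric V), actTotal ρ γ⁻¹ (actTotal ρ γ y) = y := fun γ y => by
    refine Prod.ext (inv_smul_smul γ y.1) ?_
    change quadricAct (ρ γ⁻¹) (quadricAct (ρ γ) y.2) = y.2
    rw [map_inv, quadricAct_inv_apply]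
  refine ⟨fun y => ∑ᶠ i, T i y, ⟨?_, ?_, ?_, ?_⟩, ?_⟩
  · intro y hy
    have hlf : LocallyFinite fun i => {z : M × Quadric V | T i z ≠ 0} :=
      (hφf.preimage_continuous continuous_fst).subset fun i z hz h => hz (by
        change φ i.1 (i.2 • z.1) = 0 at h
        simp [T, h])
    have hT : ∀ i, SmoothFieldAt (T i) y := by
      intro i
      have hs : ContMDiffAt ((𝓡 d).prod 𝓘(ℝ, Quadric V)) 𝓘(ℝ, ℝ) ∞
          (fun z : M × Quadric V => φ i.1 (i.2 • z.1)) y :=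
        ((hφs i.1).comp ((hsm i.2).comp contMDiff_fst)).contMDiffAt
      exact hs.smul_section (SmoothFieldAt.pullback (ρ := ρ) hsm i.2 (hX.smooth _ (hne i.2 y hy)))
    exact ContMDiffAt.finsum_section_of_locallyFinite hlf hT
  · intro y hy hy0 v hv
    obtain ⟨n, γ, hnγ⟩ := hφ1 y.1
    -- Evaluating at `(v, v)` turns the sum into one of nonnegative reals, with a strictly positive
    -- term from `hφ1`.
    let L : EuclideanSpace ℝ (Fin d) × Quadric V →ₗ[ℝ] ℝ :=
      (evalDiag v).toLinearMap.comp (LinearMap.snd ℝ _ _)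
    have hpos : ∀ i : ℕ × Γ, 0 < L (actDeriv ρ i.2⁻¹ (i.2 • y.1) (X (actTotal ρ i.2 y))) :=
      fun i => ((hX.pos _ (hmem i.2 y hy) (hne i.2 y hy0)).act (ρ i.2⁻¹)) v hv
    have hsum : L (∑ᶠ i, T i y) = ∑ᶠ i, L (T i y) := L.toAddMonoidHom.map_finsum (hTfin y)
    change 0 < L (∑ᶠ i, T i y)
    rw [hsum]
    refine finsum_pos (fun i => ?_) ⟨(n, γ), ?_⟩ ?_
    · simp only [T, map_smul, smul_eq_mul]
      exact mul_nonneg (hφ0 _ _) (hpos i).le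
    · simp only [T, map_smul, smul_eq_mul]
      exact mul_pos hnγ (hpos (n, γ))
    · exact (hTfin y).subset fun i hi h => hi (by simp [h])
  · intro y hy hy0
    refine finsum_induction (IsTangentAt u y) (isTangentAt_zero y)
      (fun _ _ h h' => h.add h') fun i => ?_
    have := IsTangentAt.act hu hρ hsm i.2⁻¹ (hmem i.2 y hy)
      (hX.tangent _ (hmem i.2 y hy) (hne i.2 y hy0))
    have h2 : IsTangentAt u y (actDeriv ρ i.2⁻¹ (i.2 • y.1) (X (actTotal ρ i.2 y))) := by
      have h3 := hback i.2 y
      rw [show actTotal ρ i.2⁻¹ ((actTotal ρ i.2 y).1, (actTotal ρ i.2 y).2) = y from h3] at this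
      exact this
    exact h2.smul _
  · intro x q c hc
    let S : EuclideanSpace ℝ (Fin d) × Quadric V →ₗ[ℝ] EuclideanSpace ℝ (Fin d) × Quadric V :=
      LinearMap.prodMap LinearMap.id (c • LinearMap.id)
    change ∑ᶠ i, T i (x, c • q) = S (∑ᶠ i, T i (x, q))
    have hsum : S (∑ᶠ i, T i (x, q)) = ∑ᶠ i, S (T i (x, q)) :=
      S.toAddMonoidHom.map_finsum (hTfin (x, q))
    rw [hsum]
    refine finsum_congr fun i => ?_
    simp only [T, map_smul]
    congr 1
    have h1 : actTotal ρ i.2 (x, c • q) = (i.2 • x, c • quadricAct (ρ i.2) q) := by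
      simp [actTotal]
    rw [h1, hX.homogeneous _ _ _ hc]
    refine Prod.ext rfl ?_
    change quadricAct (ρ i.2⁻¹) (c • _) = c • quadricAct (ρ i.2⁻¹) _
    rw [map_smul]
    rfl
  · intro γ y
    have hsum : actDeriv ρ γ y.1 (∑ᶠ i, T i y) = ∑ᶠ i, actDeriv ρ γ y.1 (T i y) :=
      (actDeriv ρ γ y.1).toAddMonoidHom.map_finsum (hTfin y)
    rw [hsum]
    -- Right translation of the index group matches the terms at `γ y` with the images of the terms
    -- at `y`.
    let e : ℕ × Γ ≃ ℕ × Γ := (Equiv.refl ℕ).prodCongr (Equiv.mulRight γ)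
    rw [← finsum_comp_equiv e]
    refine finsum_congr fun i => ?_
    change φ i.1 (i.2 • γ • y.1) • _ = actDeriv ρ γ y.1 (φ i.1 ((i.2 * γ) • y.1) •
      actDeriv ρ (i.2 * γ)⁻¹ ((i.2 * γ) • y.1) (X (actTotal ρ (i.2 * γ) y)))
    have h1 : actTotal ρ (i.2 * γ) y = actTotal ρ i.2 (actTotal ρ γ y) := by
      refine Prod.ext (mul_smul i.2 γ y.1) ?_
      change quadricAct (ρ (i.2 * γ)) y.2 = quadricAct (ρ i.2) (quadricAct (ρ γ) y.2)
      rw [map_mul, quadricAct_mul_apply]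
    have h2 := actDeriv_comp (ρ := ρ) hsm γ (i.2 * γ)⁻¹ ((i.2 * γ) • y.1)
      (X (actTotal ρ i.2 (actTotal ρ γ y)))
    rw [inv_smul_smul] at h2
    rw [map_smul, h1, h2, mul_inv_rev, mul_inv_cancel_left, mul_smul]
    rfl

variable [T2Space M] [SecondCountableTopology M]

/-- Solve on the closed set of fibre vectors of norm 1, then extend along rays: the `M`-component is
constant and the `𝒬`-component scales with the norm. -/
theorem IsFittingImmersion.exists_isPositiveField (hu : IsFittingImmersion u) :
    ∃ X, IsPositiveField u X := by
  let Z : Set (M × Quadric V) := {y | y.2 ∈ (u y.1).1} ∩ {y | euclideanNorm y.2 = 1}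
  have hZ : IsClosed Z := hu.smooth.isClosed_total.inter
    (isClosed_eq (continuous_euclideanNorm.comp continuous_snd) continuous_const)
  obtain ⟨X, hX, hXZ⟩ := hu.exists_field_on_closed hZ
    fun y hy => ⟨hy.1, ne_zero_of_euclideanNorm_eq_one hy.2⟩
  let r : M × Quadric V → M × Quadric V := fun y => (y.1, (euclideanNorm y.2)⁻¹ • y.2)
  have hrZ : ∀ y : M × Quadric V, y.2 ∈ (u y.1).1 → y.2 ≠ 0 → r y ∈ Z := fun y hy hy0 =>
    ⟨(u y.1).1.smul_mem _ hy, euclideanNorm_normalize hy0⟩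
  refine ⟨fun y => ((X (r y)).1, euclideanNorm y.2 • (X (r y)).2), ?_, ?_, ?_, ?_⟩
  · intro y hy
    obtain ⟨h1, h2⟩ := smoothFieldAt_iff.1 (hX (r y))
    have hν : ContMDiffAt ((𝓡 d).prod 𝓘(ℝ, Quadric V)) 𝓘(ℝ, ℝ) ∞
        (fun z : M × Quadric V => euclideanNorm z.2) y :=
      (contDiffAt_euclideanNorm hy).contMDiffAt.comp y contMDiffAt_snd
    have hνi : ContMDiffAt ((𝓡 d).prod 𝓘(ℝ, Quadric V)) 𝓘(ℝ, ℝ) ∞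
        (fun z : M × Quadric V => (euclideanNorm z.2)⁻¹) y :=
      ((contDiffAt_euclideanNorm hy).inv (euclideanNorm_pos hy).ne').contMDiffAt.comp y
        contMDiffAt_snd
    have hr : ContMDiffAt ((𝓡 d).prod 𝓘(ℝ, Quadric V)) ((𝓡 d).prod 𝓘(ℝ, Quadric V)) ∞ r y :=
      contMDiffAt_fst.prodMk (hνi.smul contMDiffAt_snd)
    exact smoothFieldAt_iff.2 ⟨h1.comp y hr, hν.smul (h2.comp y hr)⟩
  · exact fun y hy hy0 => (hXZ _ (hrZ y hy hy0)).1.smul (euclideanNorm_pos hy0)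
  · intro y hy hy0
    have := (hXZ _ (hrZ y hy hy0)).2.scale (euclideanNorm y.2)
    rwa [smul_smul, mul_inv_cancel₀ (euclideanNorm_pos hy0).ne', one_smul] at this
  · intro x q c hc
    have : r (x, c • q) = r (x, q) := by
      simp only [r, euclideanNorm_smul hc, smul_smul, mul_inv]
      rw [mul_right_comm, inv_mul_cancel₀ hc.ne', one_mul]
    simp only [this, euclideanNorm_smul hc, mul_smul]

end GlobalField

/-! ### An invariant exhaustion and control of its growth -/

section CompleteField

variable {V : Type*} [NormedAddCommGroup V] [NormedSpace ℝ V] [FiniteDimensional ℝ V]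
  {d : ℕ} {M : Type*} [TopologicalSpace M]
  [ChartedSpace (EuclideanSpace ℝ (Fin d)) M]
  {u : M → Gr d (Quadric V)}

variable {Γ : Type*} [Group Γ] [MulAction Γ M] {ρ : Γ →* SpecialLinearGroup ℝ V}

variable (d M Γ) in
/-- An invariant smooth function with cocompact sublevel sets. -/
theorem exists_invariant_exhaustion
    (hsm : ∀ γ : Γ, ContMDiff (𝓡 d) (𝓡 d) ∞ (fun x : M => γ • x))
    {φ : ℕ → M → ℝ} {C : ℕ → Set M}
    (hφs : ∀ n, ContMDiff (𝓡 d) 𝓘(ℝ, ℝ) ∞ (φ n)) (hφ0 : ∀ n x, 0 ≤ φ n x)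
    (hφC : ∀ n, ∀ x ∈ C n, φ n x = 1) (hC : ∀ x, ∃ n, ∃ γ : Γ, γ • x ∈ C n)
    (hφf : LocallyFinite (fun i : ℕ × Γ => {x : M | φ i.1 (i.2 • x) ≠ 0})) :
    ∃ h : M → ℝ, ContMDiff (𝓡 d) 𝓘(ℝ, ℝ) ∞ h ∧ (∀ (γ : Γ) x, h (γ • x) = h x) ∧
      ∀ x, ∃ n : ℕ, (n : ℝ) ≤ h x ∧ ∃ γ : Γ, γ • x ∈ C n := by
  -- Where a translate of `x` lies in `C n`, the corresponding term is exactly `n`, and all other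
  -- terms are nonnegative.
  let T : ℕ × Γ → M → ℝ := fun i x => i.1 * φ i.1 (i.2 • x)
  have hT0 : ∀ i x, 0 ≤ T i x := fun i x => mul_nonneg (Nat.cast_nonneg _) (hφ0 _ _)
  refine ⟨fun x => ∑ᶠ i, T i x, ?_, ?_, ?_⟩
  · refine contMDiff_finsum (fun i => ?_) (hφf.subset fun i x hx h => hx ?_)
    · exact contMDiff_const.mul ((hφs i.1).comp (hsm i.2))
    · change φ i.1 (i.2 • x) = 0 at h
      simp [T, h]
  · intro γ x
    let e : ℕ × Γ ≃ ℕ × Γ := (Equiv.refl ℕ).prodCongr (Equiv.mulRight γ)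
    change ∑ᶠ i, T i (γ • x) = ∑ᶠ i, T i x
    rw [← finsum_comp_equiv e (f := fun i => T i x)]
    refine finsum_congr fun i => ?_
    change (i.1 : ℝ) * φ i.1 (i.2 • γ • x) = i.1 * φ i.1 ((i.2 * γ) • x)
    rw [mul_smul]
  · intro x
    obtain ⟨n, γ, hγ⟩ := hC x
    refine ⟨n, ?_, γ, hγ⟩
    have hfin : (Function.support fun i => T i x).Finite :=
      (hφf.point_finite x).subset fun i hi h => hi (by
        change φ i.1 (i.2 • x) = 0 at h
        simp [T, h])
    have h1 : T (n, γ) x = n := by simp [T, hφC n _ hγ]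
    rw [← h1]
    exact single_le_finsum (n, γ) hfin fun i => hT0 i x

variable [IsManifold (𝓡 d) ∞ M]

theorem IsPositiveField.scale {X : M × Quadric V → EuclideanSpace ℝ (Fin d) × Quadric V}
    (hX : IsPositiveField u X) {f : M × Quadric V → ℝ}
    (hf : ∀ y : M × Quadric V, y.2 ≠ 0 →
      ContMDiffAt ((𝓡 d).prod 𝓘(ℝ, Quadric V)) 𝓘(ℝ, ℝ) ∞ f y)
    (hpos : ∀ y, 0 < f y) (hhom : ∀ x q (c : ℝ), 0 < c → f (x, c • q) = f (x, q)) :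
    IsPositiveField u (fun y => f y • X y) where
  smooth y hy := ContMDiffAt.smul_section (hf y hy) (hX.smooth y hy)
  pos y hy hy0 := (hX.pos y hy hy0).smul (hpos y)
  tangent y hy hy0 := (hX.tangent y hy hy0).smul (f y)
  homogeneous x q c hc := by
    simp only [hX.homogeneous x q c hc, hhom x q c hc]
    exact Prod.ext rfl (smul_comm _ _ _)

/-- The differential of a real function on a manifold, as a linear form on the model space. -/
noncomputable def derivForm (h : M → ℝ) (x : M) : EuclideanSpace ℝ (Fin d) →L[ℝ] ℝ :=
  mfderiv (𝓡 d) 𝓘(ℝ, ℝ) h x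

/-- An equivariant positive field, with an invariant exhaustion of bounded derivative. -/
theorem IsFittingImmersion.exists_complete_field [T2Space M] [SecondCountableTopology M]
    [ContinuousConstSMul Γ M] [ProperlyDiscontinuousSMul Γ M] (hu : IsFittingImmersion u)
    (hρ : IsEquivariant ρ u) :
    ∃ (X : M × Quadric V → EuclideanSpace ℝ (Fin d) × Quadric V) (h : M → ℝ) (C : ℕ → Set M),
      IsPositiveField u X ∧ (∀ (γ : Γ) y, X (actTotal ρ γ y) = actDeriv ρ γ y.1 (X y)) ∧
      ContMDiff (𝓡 d) 𝓘(ℝ, ℝ) ∞ h ∧ (∀ n, IsCompact (C n)) ∧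
      (∀ x, ∃ n : ℕ, (n : ℝ) ≤ h x ∧ ∃ γ : Γ, γ • x ∈ C n) ∧
      ∀ y : M × Quadric V, |derivForm h y.1 (X y).1| ≤ 1 := by
  have hsm := fun γ : Γ => hu.contMDiff_smul hρ γ
  obtain ⟨φ, C, hφs, hφ0, hCc, hφC, hC, hφf⟩ := exists_cutoff d M Γ
  obtain ⟨h, hhs, hhi, hhC⟩ := exists_invariant_exhaustion d M Γ hsm hφs hφ0 hφC hC hφf
  obtain ⟨X₀, hX₀⟩ := hu.exists_isPositiveField
  obtain ⟨X, hX, hXe⟩ := hX₀.exists_equivariant hu.smooth hρ hsm hφs hφ0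
    (fun x => by
      obtain ⟨n, γ, hγ⟩ := hC x
      exact ⟨n, γ, by rw [hφC n _ hγ]; exact one_pos⟩) hφf
  -- The speed of `h` along `X` is invariant under `Γ` and constant on rays, so dividing `X` by `1 +
  -- δ²` keeps every property and brings the speed to `δ / (1 + δ²)`, of absolute value at most 1.
  let δ : M × Quadric V → ℝ := fun y => derivForm h y.1 (X y).1
  have hδ : ∀ y : M × Quadric V, y.2 ≠ 0 →
      ContMDiffAt ((𝓡 d).prod 𝓘(ℝ, Quadric V)) 𝓘(ℝ, ℝ) ∞ δ y := fun y hy =>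
    contMDiffAt_mfderiv_apply isOpen_univ (fun x _ => hhs x) (b := fun z : M × Quadric V => z.1)
      (v := fun z => (X z).1) (mem_univ _) (smoothFieldAt_iff.1 (hX.smooth y hy)).1
  have hpos : ∀ y, 0 < 1 + δ y ^ 2 := fun y => by positivity
  have hδact : ∀ (γ : Γ) y, δ (actTotal ρ γ y) = δ y := by
    intro γ y
    have h1 : mfderiv (𝓡 d) 𝓘(ℝ, ℝ) h y.1 = (mfderiv (𝓡 d) 𝓘(ℝ, ℝ) h (γ • y.1)).comp
        (mfderiv (𝓡 d) (𝓡 d) (fun x : M => γ • x) y.1) := by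
      rw [← mfderiv_comp y.1 (hhs.mdifferentiableAt (by simp))
        ((hsm γ).mdifferentiableAt (by simp))]
      congr 1
      funext x
      exact (hhi γ x).symm
    have h2 : (X (actTotal ρ γ y)).1 = (actDeriv ρ γ y.1 (X y)).1 := by rw [hXe]
    change mfderiv (𝓡 d) 𝓘(ℝ, ℝ) h (γ • y.1) (X (actTotal ρ γ y)).1 = _
    rw [h2]
    exact (congrArg (fun L : EuclideanSpace ℝ (Fin d) →L[ℝ] ℝ => L (X y).1) h1).symm
  refine ⟨fun y => (1 + δ y ^ 2)⁻¹ • X y, h, C, ?_, ?_, hhs, hCc, hhC, ?_⟩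
  · refine hX.scale (fun y hy => ?_) (fun y => inv_pos.2 (hpos y)) fun x q c hc => ?_
    · have h1 : ContDiffAt ℝ ∞ (fun r : ℝ => (1 + r ^ 2)⁻¹) (δ y) :=
        ContDiffAt.inv (by fun_prop) (hpos y).ne'
      exact h1.contMDiffAt.comp y (hδ y hy)
    · simp only [δ, hX.homogeneous x q c hc]
  · intro γ y
    simp only [hδact, hXe, map_smul]
  · intro y
    have h1 : derivForm h y.1 ((1 + δ y ^ 2)⁻¹ • X y).1 =
        (1 + δ y ^ 2)⁻¹ * δ y := map_smul (derivForm h y.1) _ _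
    rw [h1, abs_mul, abs_of_pos (inv_pos.2 (hpos y)), inv_mul_le_iff₀ (hpos y), mul_one]
    nlinarith [sq_abs (δ y), sq_nonneg (|δ y| - 1), sq_nonneg (|δ y|)]

end CompleteField

/-! ### Local flows on a manifold by Picard–Lindelöf -/

section LocalFlow

variable {E : Type*} [NormedAddCommGroup E] [NormedSpace ℝ E] [CompleteSpace E]
  {H : Type*} [TopologicalSpace H] {I : ModelWithCorners ℝ E H} [I.Boundaryless]
  {N : Type*} [TopologicalSpace N] [ChartedSpace H N] [IsManifold I 1 N]

/-- A `C¹` vector field on a manifold has continuous local flows. -/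
theorem exists_local_flow_of_contMDiffAt {v : (x : N) → TangentSpace I x} {x₀ : N}
    (hv : ContMDiffAt I I.tangent 1 (fun x => (⟨x, v x⟩ : TangentBundle I N)) x₀) :
    ∃ U ∈ 𝓝 x₀, ∃ ε > 0, ∃ φ : ℝ × N → N, ContinuousOn φ (Ioo (-ε) ε ×ˢ U) ∧
      ∀ y ∈ U, φ (0, y) = y ∧ ∀ t ∈ Ioo (-ε) ε, HasMFDerivAt 𝓘(ℝ, ℝ) I (fun s => φ (s, y)) t
        ((1 : ℝ →L[ℝ] ℝ).smulRight (v (φ (t, y)))) := by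
  rw [contMDiffAt_iff] at hv
  obtain ⟨_, hv⟩ := hv
  have hx₀ : I.IsInteriorPoint x₀ := BoundarylessManifold.isInteriorPoint
  obtain ⟨ε, hε, a, r, L, K, hr, hpl⟩ :=
    IsPicardLindelof.of_contDiffAt_one (hv.contDiffAt (range_mem_nhds_isInteriorPoint hx₀)).snd
  obtain ⟨α, hα, hαc⟩ := (hpl 0).exists_forall_mem_closedBall_eq_hasDerivWithinAt_continuousOn
  simp only [zero_sub, zero_add] at hα hαc
  let z₀ := extChartAt I x₀ x₀
  have hz₀ : α (z₀, 0) = z₀ := (hα z₀ (Metric.mem_closedBall_self r.2)).1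
  have hcont : ContinuousAt α (z₀, 0) := hαc.continuousAt (prod_mem_nhds
    (Metric.closedBall_mem_nhds _ hr) (Icc_mem_nhds (by linarith) hε))
  -- Joint continuity of the Picard–Lindelöf solution keeps it in the chart for short times,
  -- uniformly in the initial point.
  have htar : ∀ᶠ w in 𝓝 (z₀, (0 : ℝ)), α w ∈ interior (extChartAt I x₀).target := by
    refine hcont.eventually (isOpen_interior.mem_nhds ?_)
    rw [hz₀]
    exact I.isInteriorPoint_iff.1 hx₀
  rw [nhds_prod_eq] at htar
  obtain ⟨p, hp, p', hp', hpp⟩ := Filter.eventually_prod_iff.1 htar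
  obtain ⟨η, hη, hηp⟩ := Metric.eventually_nhds_iff_ball.1 hp'
  let U : Set N := {y | y ∈ (extChartAt I x₀).source ∧ p (extChartAt I x₀ y) ∧
    extChartAt I x₀ y ∈ Metric.closedBall z₀ r}
  have hU : U ∈ 𝓝 x₀ := by
    have hc := continuousAt_extChartAt (I := I) x₀
    filter_upwards [extChartAt_source_mem_nhds (I := I) x₀, hc.eventually hp,
      hc.preimage_mem_nhds (Metric.closedBall_mem_nhds _ hr)] with y h1 h2 h3
    exact ⟨h1, h2, h3⟩
  let e := min ε η
  have he : 0 < e := lt_min hε hη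
  have hsub : ∀ t ∈ Ioo (-e) e, t ∈ Ioo (-ε) ε ∧ p' t := fun t ht =>
    ⟨⟨by linarith [ht.1, min_le_left ε η], by linarith [ht.2, min_le_left ε η]⟩,
      hηp t (by rw [Metric.mem_ball, Real.dist_eq, sub_zero, abs_lt]
                exact ⟨by linarith [ht.1, min_le_right ε η], by linarith [ht.2, min_le_right ε η]⟩)⟩
  refine ⟨U, hU, e, he, fun w => (extChartAt I x₀).symm (α (extChartAt I x₀ w.2, w.1)), ?_, ?_⟩
  · refine (continuousOn_extChartAt_symm x₀).comp (s := Ioo (-e) e ×ˢ U) (hαc.comp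
      (f := fun w : ℝ × N => (extChartAt I x₀ w.2, w.1)) ?_ ?_) ?_
    · refine ContinuousOn.prodMk ?_ continuousOn_fst
      exact (continuousOn_extChartAt x₀).comp continuousOn_snd fun w hw => hw.2.1
    · rintro w ⟨h1, h2⟩
      exact ⟨h2.2.2, Ioo_subset_Icc_self (hsub _ h1).1⟩
    · rintro w ⟨h1, h2⟩
      exact interior_subset (hpp h2.2.1 (hsub _ h1).2)
  · intro y hy
    refine ⟨?_, fun t ht => ?_⟩
    · change (extChartAt I x₀).symm (α (extChartAt I x₀ y, 0)) = y
      rw [(hα _ hy.2.2).1, (extChartAt I x₀).left_inv hy.1]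
    let f : ℝ → E := fun s => α (extChartAt I x₀ y, s)
    change HasMFDerivAt 𝓘(ℝ, ℝ) I ((extChartAt I x₀).symm ∘ f) t _
    let xₜ : N := (extChartAt I x₀).symm (f t)
    have h : HasDerivAt f (x := t) <| fderivWithin ℝ (extChartAt I x₀ ∘ (extChartAt I xₜ).symm)
        (range I) (extChartAt I xₜ xₜ) (v xₜ) :=
      ((hα _ hy.2.2).2 t (Ioo_subset_Icc_self (hsub t ht).1)).hasDerivAt
        (Icc_mem_nhds (hsub t ht).1.1 (hsub t ht).1.2)
    rw [← tangentCoordChange_def] at h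
    have hf3 : f t ∈ interior (extChartAt I x₀).target := hpp hy.2.1 (hsub t ht).2
    have hf3' := mem_of_mem_of_subset hf3 interior_subset
    have hft1 := mem_preimage.mp <|
      mem_of_mem_of_subset hf3' (extChartAt I x₀).target_subset_preimage_source
    have hft2 := mem_extChartAt_source (I := I) xₜ
    let w : E := v xₜ
    -- The ODE was solved in the chart at `x₀`, while the manifold derivative at time `t` uses the
    -- chart at `xₜ`; the two coordinate changes cancel.
    have hw : tangentCoordChange I x₀ xₜ xₜ (tangentCoordChange I xₜ x₀ xₜ w) = w :=
      (tangentCoordChange_comp (v := w) ⟨⟨hft2, hft1⟩, hft2⟩).trans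
        (tangentCoordChange_self (I := I) hft2)
    have hchange : HasFDerivAt (extChartAt I xₜ ∘ (extChartAt I x₀).symm)
        (tangentCoordChange I x₀ xₜ xₜ) (f t) := by
      refine HasFDerivWithinAt.hasFDerivAt (s := range I) ?_ <|
        mem_nhds_iff.mpr ⟨interior (extChartAt I x₀).target,
          subset_trans interior_subset (extChartAt_target_subset_range ..),
          isOpen_interior, hf3⟩
      rw [← (extChartAt I x₀).right_inv hf3']
      exact hasFDerivWithinAt_tangentCoordChange ⟨hft1, hft2⟩
    have hd : HasDerivAt ((extChartAt I xₜ ∘ (extChartAt I x₀).symm) ∘ f)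
        (tangentCoordChange I x₀ xₜ xₜ (tangentCoordChange I xₜ x₀ xₜ w)) t :=
      hchange.comp_hasDerivAt t h
    rw [hw] at hd
    have hd' : HasFDerivAt ((extChartAt I xₜ ∘ (extChartAt I x₀).symm) ∘ f)
        ((1 : ℝ →L[ℝ] ℝ).smulRight w) t := by
      rw [hasFDerivAt_iff_hasDerivAt]
      simpa using hd
    exact ⟨(continuousAt_extChartAt_symm'' hf3').comp h.continuousAt, hd'.hasFDerivWithinAt⟩

end LocalFlow

/-! ### Identities for the derivative of the projection -/

section ProjDeriv

variable {E : Type*} [NormedAddCommGroup E] [NormedSpace ℝ E] [FiniteDimensional ℝ E]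
  {d k : ℕ} {M : Type*} [TopologicalSpace M] [ChartedSpace (EuclideanSpace ℝ (Fin d)) M]
  {u : M → Gr k E}

/-- Projections with the same kernel satisfy `P_y P_x = P_y`; differentiate in `y` at `x`. -/
theorem IsSmooth.projDeriv_projAlong (hu : IsSmooth (d := d) u) {x : M} {H : Submodule ℝ E}
    (h : IsCompl (u x).1 H) (v : EuclideanSpace ℝ (Fin d)) (e : E) :
    projDeriv u H x v (projAlong H (u x).1 e) = projDeriv u H x v e := by
  let D : EuclideanSpace ℝ (Fin d) →L[ℝ] E →L[ℝ] E := projDeriv u H x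
  have key : ∀ a : E, HasMFDerivAt (𝓡 d) 𝓘(ℝ, E) (fun y => projAlong H (u y).1 a) x
      (D.flip a : EuclideanSpace ℝ (Fin d) →L[ℝ] E) := by
    intro a
    refine (HasMFDerivAt.clm_apply_vector (hu.hasMFDerivAt_projAlong h)
      (hasMFDerivAt_const (I := 𝓡 d) (I' := 𝓘(ℝ, E)) a x)).congr_mfderiv ?_
    change (projAlong H (u x).1).comp (0 : EuclideanSpace ℝ (Fin d) →L[ℝ] E) + D.flip a = D.flip a
    simp
  have h1 := hasMFDerivAt_unique (key (projAlong H (u x).1 e)) ((key e).congr_of_eventuallyEq (by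
    filter_upwards [(hu x H h).1] with y hy
    exact projAlong_comp h hy e))
  exact congrArg (fun L : EuclideanSpace ℝ (Fin d) →L[ℝ] E => L v) h1

/-- Here `P_x P_y = P_x` is constant in `y`. -/
theorem IsSmooth.projAlong_projDeriv (hu : IsSmooth (d := d) u) {x : M} {H : Submodule ℝ E}
    (h : IsCompl (u x).1 H) (v : EuclideanSpace ℝ (Fin d)) (e : E) :
    projAlong H (u x).1 (projDeriv u H x v e) = 0 := by
  let D : EuclideanSpace ℝ (Fin d) →L[ℝ] E →L[ℝ] E := projDeriv u H x
  have key : HasMFDerivAt (𝓡 d) 𝓘(ℝ, E) (fun y => projAlong H (u y).1 e) x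
      (D.flip e : EuclideanSpace ℝ (Fin d) →L[ℝ] E) := by
    refine (HasMFDerivAt.clm_apply_vector (hu.hasMFDerivAt_projAlong h)
      (hasMFDerivAt_const (I := 𝓡 d) (I' := 𝓘(ℝ, E)) e x)).congr_mfderiv ?_
    change (projAlong H (u x).1).comp (0 : EuclideanSpace ℝ (Fin d) →L[ℝ] E) + D.flip e = D.flip e
    simp
  have h2 := (projAlong H (u x).1).hasFDerivAt.hasMFDerivAt.comp x key
  have h3 : HasMFDerivAt (𝓡 d) 𝓘(ℝ, E)
      (projAlong H (u x).1 ∘ fun y => projAlong H (u y).1 e) x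
      (0 : EuclideanSpace ℝ (Fin d) →L[ℝ] E) :=
    (hasMFDerivAt_const (I := 𝓡 d) (I' := 𝓘(ℝ, E)) (projAlong H (u x).1 e) x).congr_of_eventuallyEq
      (by
        filter_upwards [(hu x H h).1] with y hy
        exact projAlong_comp hy h e)
  exact congrArg (fun L : EuclideanSpace ℝ (Fin d) →L[ℝ] E => L v) (hasMFDerivAt_unique h2 h3)

/-- The left side is the derivative of `(x, q) ↦ P(x) q` in the direction `z`. So the retraction
onto the bundle sends `z` to itself if `z` is tangent at the retracted point, even when `q` is off
the bundle. -/
theorem IsTangentAt.projAlong_add (hu : IsSmooth (d := d) u) {x : M} {H : Submodule ℝ E}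
    (h : IsCompl (u x).1 H) {q : E} {z : EuclideanSpace ℝ (Fin d) × E}
    (hz : IsTangentAt u (x, projAlong H (u x).1 q) z) :
    projAlong H (u x).1 z.2 + projDeriv u H x z.1 q = z.2 := by
  have h1 := projAlong_of_mem h (hz H h)
  rw [map_sub] at h1
  simp only at h1
  rw [hu.projAlong_projDeriv h, sub_zero, hu.projDeriv_projAlong h] at h1
  rw [h1, sub_add_cancel]

end ProjDeriv

/-! ### Velocities of curves under retraction and symmetries -/

section Curves

variable {Q : Type*} [NormedAddCommGroup Q] [NormedSpace ℝ Q]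
  {d : ℕ} {M : Type*} [TopologicalSpace M] [ChartedSpace (EuclideanSpace ℝ (Fin d)) M]

/-- A curve in `M × Q` has velocity `z` at time `t`. -/
def HasVelocityAt (c : ℝ → M × Q) (t : ℝ) (z : EuclideanSpace ℝ (Fin d) × Q) : Prop :=
  HasMFDerivAt 𝓘(ℝ, ℝ) ((𝓡 d).prod 𝓘(ℝ, Q)) c t ((1 : ℝ →L[ℝ] ℝ).smulRight z)

theorem hasVelocityAt_iff {c : ℝ → M × Q} {t : ℝ} {z : EuclideanSpace ℝ (Fin d) × Q} :
    HasVelocityAt c t z ↔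
      HasMFDerivAt 𝓘(ℝ, ℝ) (𝓡 d) (fun s => (c s).1) t ((1 : ℝ →L[ℝ] ℝ).smulRight z.1) ∧
      HasDerivAt (fun s => (c s).2) z.2 t := by
  constructor
  · intro h
    refine ⟨(hasMFDerivAt_fst (I := 𝓡 d) (I' := 𝓘(ℝ, Q)) (c t)).comp t h, ?_⟩
    have h2 : HasFDerivAt (fun s => (c s).2) ((1 : ℝ →L[ℝ] ℝ).smulRight z.2) t :=
      ((hasMFDerivAt_snd (I := 𝓡 d) (I' := 𝓘(ℝ, Q)) (c t)).comp t h).hasFDerivAt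
    simpa using h2.hasDerivAt
  · rintro ⟨h1, h2⟩
    have h3 : HasFDerivAt (fun s => (c s).2) ((1 : ℝ →L[ℝ] ℝ).smulRight z.2) t := by
      rw [hasFDerivAt_iff_hasDerivAt]
      simpa using h2
    exact h1.prodMk h3.hasMFDerivAt

theorem HasVelocityAt.projAlong [FiniteDimensional ℝ Q] {k : ℕ} {u : M → Gr k Q}
    (hu : IsSmooth (d := d) u) {H : Submodule ℝ Q} {c : ℝ → M × Q} {t : ℝ}
    (h : IsCompl (u (c t).1).1 H) {z : EuclideanSpace ℝ (Fin d) × Q}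
    (hz : IsTangentAt u ((c t).1, projAlong H (u (c t).1).1 (c t).2) z)
    (hc : HasVelocityAt c t z) :
    HasVelocityAt (fun s => ((c s).1, projAlong H (u (c s).1).1 (c s).2)) t z := by
  rw [hasVelocityAt_iff] at hc ⊢
  refine ⟨hc.1, ?_⟩
  let D : EuclideanSpace ℝ (Fin d) →L[ℝ] Q →L[ℝ] Q := projDeriv u H (c t).1
  let A' : ℝ →L[ℝ] Q →L[ℝ] Q := D.comp ((1 : ℝ →L[ℝ] ℝ).smulRight z.1)
  have h1 : HasFDerivAt (fun s => FittingFlow.projAlong H (u (c s).1).1) A' t :=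
    (HasMFDerivAt.comp (f := fun s => (c s).1) t (hu.hasMFDerivAt_projAlong h) hc.1).hasFDerivAt
  have h2 : HasDerivAt (fun s => FittingFlow.projAlong H (u (c s).1).1) (D z.1) t := by
    simpa [A'] using h1.hasDerivAt
  have h3 := h2.clm_apply hc.2
  have h4 := hz.projAlong_add hu h
  rw [add_comm] at h4
  rw [← h4]
  exact h3

theorem HasVelocityAt.act {V : Type*} [NormedAddCommGroup V] [NormedSpace ℝ V]
    [FiniteDimensional ℝ V] {Γ : Type*} [Group Γ] [MulAction Γ M]
    (ρ : Γ →* SpecialLinearGroup ℝ V)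
    (hsm : ∀ γ : Γ, ContMDiff (𝓡 d) (𝓡 d) ∞ (fun x : M => γ • x)) (γ : Γ) (r : ℝ)
    {c : ℝ → M × Quadric V} {t : ℝ} {z : EuclideanSpace ℝ (Fin d) × Quadric V}
    (hc : HasVelocityAt c t z) :
    HasVelocityAt (fun s => (γ • (c s).1, r • quadricAct (ρ γ) (c s).2)) t
      ((actDeriv ρ γ (c t).1 z).1, r • (actDeriv ρ γ (c t).1 z).2) := by
  rw [hasVelocityAt_iff] at hc ⊢
  constructor
  · have h1 := (((hsm γ).mdifferentiableAt (by simp)).hasMFDerivAt (x := (c t).1)).comp t hc.1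
    refine h1.congr_mfderiv ?_
    ext
    let L : EuclideanSpace ℝ (Fin d) →L[ℝ] EuclideanSpace ℝ (Fin d) :=
      mfderiv (𝓡 d) (𝓡 d) (fun y : M => γ • y) (c t).1
    change L ((1 : ℝ) • z.1) = (1 : ℝ) • L z.1
    rw [map_smul]
  · exact ((LinearMap.toContinuousLinearMap (quadricAct (ρ γ))).hasFDerivAt.comp_hasDerivAt t
      hc.2).const_smul r

end Curves

/-! ### Integral curves in the punctured bundle -/

section BundleODE

variable {V : Type*} [NormedAddCommGroup V] [NormedSpace ℝ V] [FiniteDimensional ℝ V]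
  {d : ℕ} {M : Type*} [TopologicalSpace M]
  [ChartedSpace (EuclideanSpace ℝ (Fin d)) M] [IsManifold (𝓡 d) ∞ M]
  {u : M → Gr d (Quadric V)}

/-- Integral curves in the punctured bundle of a vector field on `M × 𝒬`. -/
def BundleODE (u : M → Gr d (Quadric V))
    (X : M × Quadric V → EuclideanSpace ℝ (Fin d) × Quadric V) (c : ℝ → PuncturedBundle u)
    (t : ℝ) : Prop :=
  HasVelocityAt (fun s => (c s).1) t (X (c t).1)

theorem SmoothFieldAt.comp_projAlong (hu : IsSmooth (d := d) u)
    {X : M × Quadric V → EuclideanSpace ℝ (Fin d) × Quadric V} {H : Submodule ℝ (Quadric V)}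
    {y : M × Quadric V} (h : IsCompl (u y.1).1 H)
    (hX : SmoothFieldAt X (y.1, projAlong H (u y.1).1 y.2)) :
    SmoothFieldAt (fun z => X (z.1, projAlong H (u z.1).1 z.2)) y := by
  have hψ : ContMDiffAt ((𝓡 d).prod 𝓘(ℝ, Quadric V)) ((𝓡 d).prod 𝓘(ℝ, Quadric V)) ∞
      (fun z : M × Quadric V => (z.1, projAlong H (u z.1).1 z.2)) y :=
    contMDiffAt_fst.prodMk
      (((hu.contMDiffAt_projAlong h).comp y contMDiffAt_fst).clm_apply contMDiffAt_snd)
  rw [smoothFieldAt_iff] at hX ⊢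
  exact ⟨hX.1.comp y hψ, ContMDiffAt.comp (g := fun z => (X z).2) y hX.2 hψ⟩

/-- Let `ψ` be the local retraction onto the bundle. The flow of the ambient field `X ∘ ψ`, followed
by `ψ`, stays in the bundle, and by tangency its velocity is still `X ∘ ψ`, that is, `X` at the
retracted point. No invariance of the bundle under an ambient flow is needed. -/
theorem IsPositiveField.exists_bundle_flow (hu : IsSmooth (d := d) u)
    {X : M × Quadric V → EuclideanSpace ℝ (Fin d) × Quadric V} (hX : IsPositiveField u X)
    (p : PuncturedBundle u) :
    ∃ U ∈ 𝓝 p, ∃ ε > 0, ∃ φ : ℝ × PuncturedBundle u → PuncturedBundle u,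
      ContinuousOn φ (Ioo (-ε) ε ×ˢ U) ∧
      ∀ y ∈ U, φ (0, y) = y ∧ ∀ t ∈ Ioo (-ε) ε, BundleODE u X (fun s => φ (s, y)) t := by
  have hM : IsManifold (𝓡 d) 1 M := IsManifold.of_le (n := ∞) (by simp)
  obtain ⟨H, hH⟩ := (u p.1.1).1.exists_isCompl
  let ψ : M × Quadric V → M × Quadric V := fun z => (z.1, projAlong H (u z.1).1 z.2)
  let G : Set (M × Quadric V) := {z | IsCompl (u z.1).1 H ∧ (ψ z).2 ≠ 0}
  have hψp : ψ p.1 = p.1 := Prod.ext rfl (projAlong_of_mem hH p.2.1)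
  have hψc : ∀ z : M × Quadric V, IsCompl (u z.1).1 H → ContinuousAt ψ z := fun z hz =>
    continuousAt_fst.prodMk
      (((hu.contMDiffAt_projAlong hz).continuousAt.comp continuousAt_fst).clm_apply
        continuousAt_snd)
  have hpG : p.1 ∈ G := ⟨hH, by rw [hψp]; exact p.2.2⟩
  have hG : G ∈ 𝓝 p.1 := by
    filter_upwards [continuousAt_fst.eventually ((hu.isOpen_isCompl H).mem_nhds hH),
      ((continuous_snd.continuousAt.comp (hψc p.1 hH)).eventually_ne hpG.2)] with z h1 h2
    exact ⟨h1, h2⟩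
  have hsm := SmoothFieldAt.comp_projAlong hu (X := X) hH (by
    have := hX.smooth p.1 p.2.2
    rwa [← hψp] at this)
  obtain ⟨U, hU, ε, hε, φ, hφc, hφ⟩ := exists_local_flow_of_contMDiffAt
    (I := (𝓡 d).prod 𝓘(ℝ, Quadric V)) (v := fun z : M × Quadric V => X (ψ z))
    (hsm.of_le (by simp))
  have h0 : φ (0, p.1) = p.1 := (hφ _ (mem_of_mem_nhds hU)).1
  have hcont : ContinuousAt φ (0, p.1) := hφc.continuousAt
    (prod_mem_nhds (Ioo_mem_nhds (by linarith) hε) hU)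
  have hev : ∀ᶠ w in 𝓝 ((0 : ℝ), p.1), φ w ∈ G := hcont.eventually (by rw [h0]; exact hG)
  rw [nhds_prod_eq] at hev
  obtain ⟨P, hP, P', hP', hPP⟩ := Filter.eventually_prod_iff.1 hev
  obtain ⟨η, hη, hηP⟩ := Metric.eventually_nhds_iff_ball.1 hP
  let e := min ε η
  have he : 0 < e := lt_min hε hη
  have hsub : ∀ t ∈ Ioo (-e) e, t ∈ Ioo (-ε) ε ∧ P t := fun t ht =>
    ⟨⟨by linarith [ht.1, min_le_left ε η], by linarith [ht.2, min_le_left ε η]⟩,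
      hηP t (by rw [Metric.mem_ball, Real.dist_eq, sub_zero, abs_lt]
                exact ⟨by linarith [ht.1, min_le_right ε η], by linarith [ht.2, min_le_right ε η]⟩)⟩
  classical
  -- The default `w.2` is never reached for short times near `p`, where the flow stays in `G`.
  let F : ℝ × PuncturedBundle u → PuncturedBundle u := fun w =>
    if hw : φ (w.1, w.2.1) ∈ G then ⟨ψ (φ (w.1, w.2.1)), projAlong_mem hw.1 _, hw.2⟩ else w.2
  have hF : ∀ w : ℝ × PuncturedBundle u, φ (w.1, w.2.1) ∈ G → (F w).1 = ψ (φ (w.1, w.2.1)) :=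
    fun w hw => by simp only [F, dif_pos hw]
  let U' : Set (PuncturedBundle u) := {y | y.1 ∈ U ∧ P' y.1}
  have hU' : U' ∈ 𝓝 p := continuous_subtype_val.continuousAt.preimage_mem_nhds
    (Filter.inter_mem hU hP')
  have hmem : ∀ w ∈ Ioo (-e) e ×ˢ U', φ (w.1, w.2.1) ∈ G := fun w hw =>
    hPP (hsub _ hw.1).2 hw.2.2
  refine ⟨U', hU', e, he, F, ?_, fun y hy => ⟨?_, fun t ht => ?_⟩⟩
  · refine Topology.IsInducing.subtypeVal.continuousOn_iff.2 ?_
    refine ContinuousOn.congr (f := fun w : ℝ × PuncturedBundle u => ψ (φ (w.1, w.2.1))) ?_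
      fun w hw => hF w (hmem w hw)
    have h1 : ContinuousOn (fun w : ℝ × PuncturedBundle u => φ (w.1, w.2.1)) (Ioo (-e) e ×ˢ U') :=
      hφc.comp (f := fun w : ℝ × PuncturedBundle u => (w.1, w.2.1))
        (continuous_fst.prodMk (continuous_subtype_val.comp continuous_snd)).continuousOn
        fun w hw => ⟨(hsub _ hw.1).1, hw.2.1⟩
    exact fun w hw => ContinuousAt.comp_continuousWithinAt (g := ψ)
      (f := fun w : ℝ × PuncturedBundle u => φ (w.1, w.2.1)) (hψc _ (hmem w hw).1) (h1 w hw)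
  · have h1 : φ (0, y.1) = y.1 := (hφ _ hy.1).1
    have h2 := hmem (0, y) ⟨⟨by simpa using he, he⟩, hy⟩
    apply Subtype.ext
    rw [hF (0, y) h2]
    simp only [h1] at h2 ⊢
    exact Prod.ext rfl (projAlong_of_mem h2.1 y.2.1)
  · have h2 := hmem (t, y) ⟨ht, hy⟩
    have hvel : HasVelocityAt (fun s => φ (s, y.1)) t (X (ψ (φ (t, y.1)))) :=
      (hφ _ hy.1).2 t (hsub t ht).1
    have h3 := hvel.projAlong hu h2.1 (hX.tangent (ψ (φ (t, y.1))) (projAlong_mem h2.1 _) h2.2)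
    change HasVelocityAt (fun s => (F (s, y)).1) t (X (F (t, y)).1)
    rw [hF (t, y) h2]
    refine HasMFDerivAt.congr_of_eventuallyEq h3 ?_
    filter_upwards [isOpen_Ioo.mem_nhds ht] with s hs
    exact hF (s, y) (hmem (s, y) ⟨hs, hy⟩)

/-- Uniqueness is inherited from `M × 𝒬`, where `X` is smooth around every point off the zero
section, whether or not it lies in the bundle. -/
theorem IsPositiveField.isLocalODE (hu : IsSmooth (d := d) u)
    {X : M × Quadric V → EuclideanSpace ℝ (Fin d) × Quadric V} (hX : IsPositiveField u X) :
    IsLocalODE (BundleODE u X) where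
  congr {c c' t} h hc := by
    have h1 := HasMFDerivAt.congr_of_eventuallyEq (f₁ := fun s => (c' s).1) hc
      (h.mono fun s hs => by simp only [hs])
    have h2 : c t = c' t := h.self_of_nhds
    unfold BundleODE
    rw [← h2]
    exact h1
  translate {c s t} h := by
    unfold BundleODE at h ⊢
    rw [hasVelocityAt_iff] at h ⊢
    have h1 : HasFDerivAt (fun r : ℝ => s + r) (ContinuousLinearMap.id ℝ ℝ) t :=
      (hasFDerivAt_id t).const_add s
    refine ⟨?_, ?_⟩
    · exact HasMFDerivAt.comp (f := fun r => s + r) (g := fun r => (c r).1.1) t h.1 h1.hasMFDerivAt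
    · simpa using HasDerivAt.comp_const_add s t h.2
  cont {c t} h := Topology.IsInducing.subtypeVal.continuousAt_iff.2 h.continuousAt
  unique {c c' t} hc hc' h := by
    have hM : IsManifold (𝓡 d) 1 M := IsManifold.of_le (n := ∞) (by simp)
    have h1 := isMIntegralCurveAt_eventuallyEq_of_contMDiffAt_boundaryless
      (I := (𝓡 d).prod 𝓘(ℝ, Quadric V)) (γ := fun s => (c s).1) (γ' := fun s => (c' s).1)
      (v := X) ((hX.smooth (c t).1 (c t).2.2).of_le (by simp)) hc hc' (by simp only [h])
    exact h1.mono fun s hs => Subtype.ext hs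
  flow := hX.exists_bundle_flow hu

end BundleODE

/-! ### Descent to the sphere bundle -/

section Quotient

variable {V : Type*} [NormedAddCommGroup V] [NormedSpace ℝ V] {d : ℕ} {M : Type*}
  [TopologicalSpace M] {u : M → Gr d (Quadric V)}

theorem continuous_scaling (u : M → Gr d (Quadric V)) {c : ℝ} (hc : 0 < c) :
    Continuous fun a : PuncturedBundle u =>
      (⟨(a.1.1, c • a.1.2), (u a.1.1).1.smul_mem c a.2.1, smul_ne_zero hc.ne' a.2.2⟩ :
        PuncturedBundle u) := by
  refine Continuous.subtype_mk ?_ _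
  exact (continuous_fst.comp continuous_subtype_val).prodMk
    ((continuous_snd.comp continuous_subtype_val).const_smul c)

/-- The saturation of an open set is the union of its preimages under all scalings. Openness matters
because the product with `id` on `ℝ` is then still a quotient map, which gives joint continuity of
the descended flow. -/
theorem isOpenQuotientMap_mk (u : M → Gr d (Quadric V)) :
    IsOpenQuotientMap (SphereBundle.mk : PuncturedBundle u → SphereBundle u) where
  surjective := Quotient.exists_rep
  continuous := continuous_quotient_mk'
  isOpenMap := by
    intro U hU
    change IsOpen (SphereBundle.mk ⁻¹' (SphereBundle.mk '' U))
    have : SphereBundle.mk ⁻¹' (SphereBundle.mk '' U) = ⋃ (c : ℝ) (hc : 0 < c),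
        (fun a : PuncturedBundle u => (⟨(a.1.1, c • a.1.2), (u a.1.1).1.smul_mem c a.2.1,
          smul_ne_zero hc.ne' a.2.2⟩ : PuncturedBundle u)) ⁻¹' U := by
      ext a
      simp only [mem_preimage, mem_image, mem_iUnion]
      constructor
      · rintro ⟨b, hb, hab⟩
        obtain ⟨h, c, hc, hbc⟩ := Quotient.exact hab.symm
        refine ⟨c, hc, ?_⟩
        have : (⟨(a.1.1, c • a.1.2), (u a.1.1).1.smul_mem c a.2.1,
          smul_ne_zero hc.ne' a.2.2⟩ : PuncturedBundle u) = b :=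
          Subtype.ext (Prod.ext h hbc.symm)
        rwa [this]
      · rintro ⟨c, hc, h⟩
        refine ⟨_, h, Eq.symm (Quotient.sound ?_)⟩
        exact ⟨rfl, c, hc, rfl⟩
    rw [this]
    exact isOpen_iUnion fun c => isOpen_iUnion fun hc => hU.preimage (continuous_scaling u hc)

/-- A flow commuting with all positive scalings descends to the sphere bundle. -/
theorem exists_descend_flow (Φ : Flow ℝ (PuncturedBundle u))
    (h : ∀ t a b, (positiveScaling u).r a b → (positiveScaling u).r (Φ t a) (Φ t b)) :
    ∃ Ψ : Flow ℝ (SphereBundle u), ∀ t a, Ψ t (SphereBundle.mk a) = SphereBundle.mk (Φ t a) := by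
  let F : ℝ → SphereBundle u → SphereBundle u := fun t => Quotient.map (Φ t) (h t)
  have hF : ∀ t a, F t (SphereBundle.mk a) = SphereBundle.mk (Φ t a) := fun _ _ => rfl
  refine ⟨⟨F, ?_, ?_, ?_⟩, hF⟩
  · have hq := (IsOpenQuotientMap.id (X := ℝ)).prodMap (isOpenQuotientMap_mk u)
    rw [← hq.continuous_comp_iff]
    exact (isOpenQuotientMap_mk u).continuous.comp (Φ.continuous continuous_fst continuous_snd)
  · intro s t x
    obtain ⟨a, rfl⟩ := (isOpenQuotientMap_mk u).surjective x
    simp only [hF, Φ.map_add]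
  · intro x
    obtain ⟨a, rfl⟩ := (isOpenQuotientMap_mk u).surjective x
    simp only [hF, Φ.map_zero_apply]

end Quotient

/-! ### The group and the scalings as one family of symmetries -/

section Symmetries

variable {V : Type*} [NormedAddCommGroup V] [NormedSpace ℝ V] [FiniteDimensional ℝ V]
  {d : ℕ} {M : Type*} {u : M → Gr d (Quadric V)}
  {Γ : Type*} [Group Γ] [MulAction Γ M] {ρ : Γ →* SpecialLinearGroup ℝ V}

/-- The action of `γ`, followed by scaling with `r > 0`, on the punctured bundle. -/
noncomputable def bundleAct (hρ : IsEquivariant ρ u) (γ : Γ) {r : ℝ} (hr : 0 < r)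
    (a : PuncturedBundle u) : PuncturedBundle u :=
  ⟨(γ • a.1.1, r • quadricAct (ρ γ) a.1.2),
    (u (γ • a.1.1)).1.smul_mem r (by
      rw [hρ γ a.1.1]; exact Submodule.mem_map_of_mem a.2.1),
    smul_ne_zero hr.ne' (quadricAct_ne_zero _ a.2.2)⟩

theorem bundleAct_inv (hρ : IsEquivariant ρ u) (γ : Γ) {r : ℝ} (hr : 0 < r)
    (a : PuncturedBundle u) :
    bundleAct hρ γ⁻¹ (inv_pos.2 hr) (bundleAct hρ γ hr a) = a := by
  refine Subtype.ext (Prod.ext (inv_smul_smul γ a.1.1) ?_)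
  change r⁻¹ • quadricAct (ρ γ⁻¹) (r • quadricAct (ρ γ) a.1.2) = a.1.2
  rw [map_smul, map_inv, quadricAct_inv_apply, smul_smul, inv_mul_cancel₀ hr.ne', one_smul]

theorem mk_bundleAct [TopologicalSpace M] (hρ : IsEquivariant ρ u) (γ : Γ) {r : ℝ} (hr : 0 < r)
    (a : PuncturedBundle u) :
    SphereBundle.mk (bundleAct hρ γ hr a) = sphereAct hρ γ (SphereBundle.mk a) :=
  (Quotient.sound ⟨rfl, r, hr, rfl⟩ :
    sphereAct hρ γ (SphereBundle.mk a) = SphereBundle.mk (bundleAct hρ γ hr a)).symm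

/-- Scalings are the symmetries with `γ = 1`, so commutation with `bundleAct` yields both descent
and equivariance. -/
theorem positiveScaling_iff (hρ : IsEquivariant ρ u) {a b : PuncturedBundle u} :
    (positiveScaling u).r a b ↔ ∃ (c : ℝ) (hc : 0 < c), b = bundleAct hρ 1 hc a := by
  have key : ∀ (c : ℝ) (hc : 0 < c), (bundleAct hρ 1 hc a).1 = (a.1.1, c • a.1.2) := by
    intro c hc
    change ((1 : Γ) • a.1.1, c • quadricAct (ρ 1) a.1.2) = _
    rw [one_smul, map_one, quadricAct_one_apply]
  constructor
  · rintro ⟨h, c, hc, hb⟩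
    exact ⟨c, hc, Subtype.ext ((Prod.ext h.symm hb : b.1 = (a.1.1, c • a.1.2)).trans (key c hc).symm)⟩
  · rintro ⟨c, hc, rfl⟩
    rw [show (positiveScaling u).r a (bundleAct hρ 1 hc a) ↔
      (a.1.1 = (bundleAct hρ 1 hc a).1.1 ∧
        ∃ r : ℝ, 0 < r ∧ (bundleAct hρ 1 hc a).1.2 = r • a.1.2) from Iff.rfl, key]
    exact ⟨rfl, c, hc, rfl⟩

end Symmetries

/-! ### Growth of the exhaustion along integral curves -/

section DerivativeBound

variable {V : Type*} [NormedAddCommGroup V] [NormedSpace ℝ V] {d : ℕ} {M : Type*}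
  [TopologicalSpace M] [ChartedSpace (EuclideanSpace ℝ (Fin d)) M] {u : M → Gr d (Quadric V)}
  {X : M × Quadric V → EuclideanSpace ℝ (Fin d) × Quadric V}

theorem BundleODE.abs_sub_le {c : ℝ → PuncturedBundle u} {a : ℝ}
    (hc : ∀ t ∈ Ioo (-a) a, BundleODE u X c t) {h : M → ℝ}
    (hh : ContMDiff (𝓡 d) 𝓘(ℝ, ℝ) ∞ h) (hd : ∀ y, |derivForm h y.1 (X y).1| ≤ 1) {t : ℝ}
    (ht : t ∈ Ioo (-a) a) : |h (c t).1.1 - h (c 0).1.1| ≤ |t| := by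
  have h0 : (0 : ℝ) ∈ Ioo (-a) a := ⟨by linarith [ht.1, ht.2], by linarith [ht.1, ht.2]⟩
  have key : ∀ s ∈ Ioo (-a) a,
      HasDerivWithinAt (fun s => h (c s).1.1) (derivForm h (c s).1.1 (X (c s).1).1)
        (Ioo (-a) a) s := by
    intro s hs
    let L : ℝ →L[ℝ] ℝ := (derivForm h (c s).1.1).comp
      ((1 : ℝ →L[ℝ] ℝ).smulRight (X (c s).1).1)
    have h1 : HasFDerivAt (fun s => h (c s).1.1) L s :=
      (HasMFDerivAt.comp (f := fun s => (c s).1.1) s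
        ((hh.mdifferentiableAt (by simp)).hasMFDerivAt (x := (c s).1.1))
        (hasVelocityAt_iff.1 (hc s hs)).1).hasFDerivAt
    have h2 := h1.hasDerivAt
    simp only [L, ContinuousLinearMap.comp_apply, ContinuousLinearMap.smulRight_apply,
      one_apply_eq_self, one_smul] at h2
    exact h2.hasDerivWithinAt
  have := (convex_Ioo (-a) a).norm_image_sub_le_of_norm_hasDerivWithin_le (C := 1) key
    (fun s _ => hd _) h0 ht
  simpa using this

end DerivativeBound

/-! ### Completeness modulo the symmetries -/

section Completeness

variable {V : Type*} [NormedAddCommGroup V] [NormedSpace ℝ V] [FiniteDimensional ℝ V]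
  {d : ℕ} {M : Type*} [TopologicalSpace M]
  [ChartedSpace (EuclideanSpace ℝ (Fin d)) M]
  {u : M → Gr d (Quadric V)}
  {Γ : Type*} [Group Γ] [MulAction Γ M] {ρ : Γ →* SpecialLinearGroup ℝ V}
  {X : M × Quadric V → EuclideanSpace ℝ (Fin d) × Quadric V}

/-- It is the part of a compact product `K × sphere` inside the closed total space. -/
theorem isCompact_normalized (hu : IsSmooth (d := d) u) [T2Space M] {K : Set M} (hK : IsCompact K) :
    IsCompact {a : PuncturedBundle u | a.1.1 ∈ K ∧ euclideanNorm a.1.2 = 1} := by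
  refine Topology.IsInducing.subtypeVal.isCompact_iff.2 ?_
  have : Subtype.val '' {a : PuncturedBundle u | a.1.1 ∈ K ∧ euclideanNorm a.1.2 = 1} =
      (K ×ˢ {q : Quadric V | euclideanNorm q = 1}) ∩ {y : M × Quadric V | y.2 ∈ (u y.1).1} := by
    ext y
    constructor
    · rintro ⟨a, ha, rfl⟩
      exact ⟨ha, a.2.1⟩
    · rintro ⟨h1, h2⟩
      exact ⟨⟨y, h2, ne_zero_of_euclideanNorm_eq_one h1.2⟩, h1, rfl⟩
  exact (congrArg IsCompact this).mpr
    ((hK.prod isCompact_euclideanSphere).inter_right hu.isClosed_total)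

variable [IsManifold (𝓡 d) ∞ M]

theorem BundleODE.act (hsm : ∀ γ : Γ, ContMDiff (𝓡 d) (𝓡 d) ∞ (fun x : M => γ • x))
    (hρ : IsEquivariant ρ u) (hX : IsPositiveField u X)
    (hXe : ∀ (γ : Γ) y, X (actTotal ρ γ y) = actDeriv ρ γ y.1 (X y)) (γ : Γ) {r : ℝ} (hr : 0 < r)
    {c : ℝ → PuncturedBundle u} {t : ℝ} (hc : BundleODE u X c t) :
    BundleODE u X (fun s => bundleAct hρ γ hr (c s)) t := by
  have h1 := HasVelocityAt.act ρ hsm γ r hc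
  have h2 : X (bundleAct hρ γ hr (c t)).1 = ((actDeriv ρ γ (c t).1.1 (X (c t).1)).1,
      r • (actDeriv ρ γ (c t).1.1 (X (c t).1)).2) := by
    rw [← hXe]
    exact hX.homogeneous _ _ _ hr
  unfold BundleODE
  rw [h2]
  exact h1

/-- For fixed `v ≠ 0`, the value at `(v, v)` has positive derivative along the curve. -/
theorem BundleODE.pos_sub {X : M × Quadric V → EuclideanSpace ℝ (Fin d) × Quadric V}
    (hX : IsPositiveField u X) {c : ℝ → PuncturedBundle u} (hc : ∀ t, BundleODE u X c t) {t : ℝ}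
    (ht : 0 < t) : ((c t).1.2 - (c 0).1.2).Pos := by
  intro v hv
  have h1 : ∀ s, HasDerivAt (fun s => evalDiag v (c s).1.2) (evalDiag v (X (c s).1).2) s :=
    fun s => (evalDiag v).hasFDerivAt.comp_hasDerivAt s (hasVelocityAt_iff.1 (hc s)).2
  have h2 : StrictMono fun s => evalDiag v (c s).1.2 :=
    strictMono_of_hasDerivAt_pos h1 fun s => hX.pos _ (c s).2.1 (c s).2.2 v hv
  rw [← evalDiag_apply, map_sub, sub_pos]
  exact h2 ht

/-- Within time `T` the function `h` grows by at most `T`, so a symmetry moves each point of the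
curve to a normalized vector over one of finitely many compact sets `C n`. Existence times are
bounded below on that compact set and unchanged by symmetries. -/
theorem hasUniformDuration_bundleODE [T2Space M]
    (hsm : ∀ γ : Γ, ContMDiff (𝓡 d) (𝓡 d) ∞ (fun x : M => γ • x))
    (hu : IsSmooth (d := d) u) (hρ : IsEquivariant ρ u) (hX : IsPositiveField u X)
    (hode : IsLocalODE (BundleODE u X))
    (hXe : ∀ (γ : Γ) y, X (actTotal ρ γ y) = actDeriv ρ γ y.1 (X y)) {h : M → ℝ} {C : ℕ → Set M}
    (hh : ContMDiff (𝓡 d) 𝓘(ℝ, ℝ) ∞ h) (hC : ∀ n, IsCompact (C n))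
    (hhC : ∀ x, ∃ n : ℕ, (n : ℝ) ≤ h x ∧ ∃ γ : Γ, γ • x ∈ C n)
    (hd : ∀ y, |derivForm h y.1 (X y).1| ≤ 1) :
    HasUniformDuration (BundleODE u X) := by
  let S : ℝ → Set (PuncturedBundle u) := fun ε =>
    {y | ∃ c' : ℝ → PuncturedBundle u, c' 0 = y ∧ ∀ s ∈ Ioo (-ε) ε, BundleODE u X c' s}
  have hSmono : ∀ ε ε', ε ≤ ε' → S ε' ⊆ S ε := by
    rintro ε ε' hle y ⟨c', h0, hc'⟩
    exact ⟨c', h0, fun s hs => hc' s ⟨by linarith [hs.1], by linarith [hs.2]⟩⟩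
  have hSact : ∀ ε (γ : Γ) (r : ℝ) (hr : 0 < r) y, bundleAct hρ γ hr y ∈ S ε → y ∈ S ε := by
    rintro ε γ r hr y ⟨c', h0, hc'⟩
    refine ⟨fun s => bundleAct hρ γ⁻¹ (inv_pos.2 hr) (c' s), ?_, fun s hs =>
      (hc' s hs).act hsm hρ hX hXe _ _⟩
    simp only [h0, bundleAct_inv]
  have hScpt : ∀ K : Set (PuncturedBundle u), IsCompact K → ∃ ε > 0, K ⊆ S ε := by
    intro K hK
    refine hK.induction_on (p := fun K => ∃ ε > 0, K ⊆ S ε) ⟨1, one_pos, empty_subset _⟩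
      ?_ ?_ ?_
    · rintro s t hst ⟨ε, hε, ht⟩
      exact ⟨ε, hε, hst.trans ht⟩
    · rintro s t ⟨ε, hε, hs⟩ ⟨ε', hε', ht⟩
      exact ⟨min ε ε', lt_min hε hε', union_subset (hs.trans (hSmono _ _ (min_le_left _ _)))
        (ht.trans (hSmono _ _ (min_le_right _ _)))⟩
    · intro p _
      obtain ⟨U, hU, ε, hε, φ, -, hφ⟩ := hode.flow p
      exact ⟨U, mem_nhdsWithin_of_mem_nhds hU, ε, hε, fun y hy => ⟨_, (hφ y hy).1, (hφ y hy).2⟩⟩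
  intro y T
  obtain ⟨m, hm⟩ := exists_nat_ge (h y.1.1 + T)
  obtain ⟨ε, hε, hK⟩ := hScpt _ (isCompact_normalized hu
    ((finite_Iic m).isCompact_biUnion fun n _ => hC n))
  refine ⟨ε, hε, fun c a ha haT h0 hc t ht => ?_⟩
  have h1 := BundleODE.abs_sub_le hc hh hd ht
  have h2 : |t| < a := abs_lt.2 ht
  rw [h0] at h1
  obtain ⟨n, hn, γ, hγ⟩ := hhC (c t).1.1
  have hnm : n ≤ m := by
    have : (n : ℝ) ≤ m := by linarith [(abs_le.1 h1).2]
    exact_mod_cast this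
  have hne := quadricAct_ne_zero (ρ γ) (c t).2.2
  -- Translate by `γ` into `C n`, then rescale to norm 1.
  refine hSact ε γ (euclideanNorm (quadricAct (ρ γ) (c t).1.2))⁻¹
    (inv_pos.2 (euclideanNorm_pos hne)) _ (hK ⟨?_, euclideanNorm_normalize hne⟩)
  exact mem_biUnion (mem_Iic.2 hnm) hγ

end Completeness

/-! ### The equivariant fitting flow -/

section Main

variable {V : Type*} [NormedAddCommGroup V] [NormedSpace ℝ V] [FiniteDimensional ℝ V]
  {d : ℕ} {M : Type*} [TopologicalSpace M] [T2Space M] [SecondCountableTopology M]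
  [ChartedSpace (EuclideanSpace ℝ (Fin d)) M] [IsManifold (𝓡 d) ∞ M]
  {u : M → Gr d (Quadric V)}
  {Γ : Type*} [Group Γ] [MulAction Γ M] [ContinuousConstSMul Γ M]
  [ProperlyDiscontinuousSMul Γ M] {ρ : Γ →* SpecialLinearGroup ℝ V}

theorem IsFittingImmersion.exists_equivariant_flow (hu : IsFittingImmersion u)
    (hρ : IsEquivariant ρ u) :
    ∃ Φ : Flow ℝ (SphereBundle u), IsFittingFlow Φ ∧
      ∀ (γ : Γ) (t : ℝ) (s : SphereBundle u),
        Φ t (sphereAct hρ γ s) = sphereAct hρ γ (Φ t s) := by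
  have hsm := fun γ : Γ => hu.contMDiff_smul hρ γ
  obtain ⟨X, h, C, hX, hXe, hh, hC, hhC, hd⟩ := hu.exists_complete_field hρ
  have hode := hX.isLocalODE hu.smooth
  obtain ⟨Φ, hΦ⟩ := hode.exists_flow
    (hasUniformDuration_bundleODE hsm hu.smooth hρ hX hode hXe hh hC hhC hd)
  -- Both sides are integral curves in `t` with the same initial point.
  have hact : ∀ (γ : Γ) (r : ℝ) (hr : 0 < r) t a,
      Φ t (bundleAct hρ γ hr a) = bundleAct hρ γ hr (Φ t a) := by
    intro γ r hr t a
    exact congrFun (hode.eq_of_global (hΦ (bundleAct hρ γ hr a))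
      (fun t => (hΦ a t).act hsm hρ hX hXe γ hr) (by simp only [Φ.map_zero_apply])) t
  obtain ⟨Ψ, hΨ⟩ := exists_descend_flow Φ fun t a b hab => by
    obtain ⟨c, hc, rfl⟩ := (positiveScaling_iff hρ).1 hab
    rw [hact]
    exact (positiveScaling_iff hρ).2 ⟨c, hc, rfl⟩
  refine ⟨Ψ, fun t ht a => ⟨Φ t a, (hΨ t a).symm, ?_⟩, fun γ t s => ?_⟩
  · have := BundleODE.pos_sub hX (hΦ a) ht
    rwa [Φ.map_zero_apply] at this
  · obtain ⟨a, rfl⟩ := (isOpenQuotientMap_mk u).surjective s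
    rw [hΨ, ← mk_bundleAct hρ γ one_pos, hΨ, hact, mk_bundleAct hρ γ one_pos]

end Main

end FittingFlow

open FittingFlow in
theorem proposition4p8
    {V : Type*} [NormedAddCommGroup V] [NormedSpace ℝ V] [FiniteDimensional ℝ V]
    {d : ℕ} {M : Type*} [TopologicalSpace M] [T2Space M] [SecondCountableTopology M]
    [ChartedSpace (EuclideanSpace ℝ (Fin d)) M] [IsManifold (𝓡 d) ∞ M]
    (u : M → Gr d (Quadric V)) (hu : IsFittingImmersion u) :
    (∃ Φ : Flow ℝ (SphereBundle u), IsFittingFlow Φ) ∧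
    (∀ (Γ : Type*) [Group Γ] [MulAction Γ M] [ContinuousConstSMul Γ M]
      [ProperlyDiscontinuousSMul Γ M]
      (ρ : Γ →* SpecialLinearGroup ℝ V) (hρ : IsEquivariant ρ u),
      ∃ Φ : Flow ℝ (SphereBundle u), IsFittingFlow Φ ∧
        ∀ (γ : Γ) (t : ℝ) (s : SphereBundle u),
          Φ t (sphereAct hρ γ s) = sphereAct hρ γ (Φ t s)) := by
  refine ⟨?_, fun Γ _ _ _ _ ρ hρ => hu.exists_equivariant_flow hρ⟩
  -- The non-equivariant statement is the equivariant one for the trivial group.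
  let _ : MulAction Unit M :=
    { smul := fun _ x => x
      one_smul := fun _ => rfl
      mul_smul := fun _ _ _ => rfl }
  have : ContinuousConstSMul Unit M := ⟨fun _ => continuous_id⟩
  have : ProperlyDiscontinuousSMul Unit M := ⟨fun _ _ => Set.toFinite _⟩
  have hρ : IsEquivariant (1 : Unit →* SpecialLinearGroup ℝ V) u := fun γ x => by
    have : quadricAct ((1 : Unit →* SpecialLinearGroup ℝ V) γ) = LinearMap.id :=
      LinearMap.ext fun q => quadricAct_one_apply q
    rw [this, Submodule.map_id]
    rfl
  obtain ⟨Φ, hΦ, -⟩ := hu.exists_equivariant_flow hρ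
  exact ⟨Φ, hΦ⟩
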